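/- **Setting.** $N=[n]$; $\mathcal M$ is a matroid on $N$ of rank $k$ (given explicitly; access to it is free); $f:2^N\to\mathbb R_{\ge 0}$ is monotone and submodular; $\mathrm{OPT}=\max_{S\in\mathcal M}f(S)$; $F(x)=\sum_{S}f(S)\prod_{i\in S}x_i\prod_{i\notin S}(1-x_i)$ is the multilinear extension; $P(\mathcal M)$ is the convex hull of the indicator vectors of independent sets. A randomised algorithm with an exact value oracle for $F$ on $[0,1]^n$ is *$r$-adaptive* if it always makes its queries in at most $r$ rounds, each of at most $\mathrm{poly}(n)$ queries that do not depend on the answers to one another. *Random Sequence* of a set system $\mathcal I$: starting with the empty sequence, repeat $\mathrm{rank}(\mathcal I)$ times: append a uniformly random new element $a$ with $\{a_1,\dots,a_{i-1},a\}\in\mathcal I$. *Adaptive Sequencing* $(g,\mathcal M,\varepsilon,\Delta)$: $S\leftarrow\emptyset$, $t\leftarrow\max\{g(\{a\}):\{a\}\in\mathcal M\}$. Repeat $\Delta$ times: $X\leftarrow N$; while $X\ne\emptyset$, draw a Random Sequence $a_1,\dots,a_\ell$ of $\{T\subseteq X:S\cup T\in\mathcal M\}$, put $A_i=S\cup\{a_1,\dots,a_i\}$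 and $X_i=\{a\in X\setminus A_i: A_i\cup\{a\}\in\mathcal M,\ g(A_i\cup\{a\})-g(A_i)\ge t\}$ for $0\le i\le\ell$, let $i^\star=\min\{i:|X_i|\le(1-\varepsilon)|X|\}$, and set $S\leftarrow A_{i^\star}$, $X\leftarrow X_{i^\star}$; then $t\leftarrow(1-\varepsilon)t$. Return $S$. *Accelerated Continuous Greedy* with step size $\lambda=1/m$, $m\in\mathbb N_{\ge1}$: $x\leftarrow 0$; repeat $m$ times: let $S$ be the output of Adaptive Sequencing for $g(T)=F(x+\lambda\mathbf 1_T)-F(x)$, $\mathcal M$, $\varepsilon$ and $\Delta=\lceil\varepsilon^{-1}\log(k/(\varepsilon\lambda))\rceil$, and set $x\leftarrow x+\lambda\mathbf 1_S$. Return $x$. **Theorem.** There are a polynomial bounding the number of queries per round and, for every $n$ and every matroid $\mathcal M$ on $[n]$, a randomised rounding $\rho$, independent of $f$ and hence free of queries, that sends each $x\in P(\mathcal M)$ to a random independent set with $\mathbb E[f(\rho(x))]\ge F(x)$ for every non-negative monotone submodular $f$, such that the following holds. 1. For every $c>0$ there is $C>0$ such that for all $n$, $\mathcal M$, all $\varepsilon,\delta\in(0,1)$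 and all step sizes $\lambda=1/m$ with $\lambda\le c\,\varepsilon$ and $\lambda\le c\,\varepsilon/\log(1/\delta)$ (in particular, when $\lambda\le c\,\varepsilon$, for all $\lambda\le c\,\varepsilon^2/\log(1/\delta)$): (a) if $n\ge2$, $k\ge1$ and $\varepsilon\lambda\le\frac12$, then Accelerated Continuous Greedy is $r$-adaptive with $r\le C\,\dfrac{\log(n)\,\log(k/(\varepsilon\lambda))}{\varepsilon^2\lambda}$; (b) for every non-negative monotone submodular $f$ its output $x$ always lies in $P(\mathcal M)$, and with probability at least $1-\delta$ (over $x$) both $F(x)\ge(1-1/e-C\varepsilon)\,\mathrm{OPT}$ and $\mathbb E[f(\rho(x))\mid x]\ge(1-1/e-C\varepsilon)\,\mathrm{OPT}$. 2. There is $C>0$ such that for all $n$, $\mathcal M$ and $\varepsilon,\delta\in(0,\frac12]$, with $\lambda=\varepsilon^2/\log(1/\delta)$, Accelerated Continuous Greedy with step size $1/\lceil\varepsilon/\lambda\rceil$ satisfies (b) and, if $n\ge2$ and $k\ge1$, is $r$-adaptive with $r\le C\,\dfrac{\log(n)\,\log(k/(\varepsilon\lambda))}{\varepsilon\lambda}$.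 -/

import Mathlib

open scoped Classical

noncomputable section

namespace Adaptive

/-! ### Randomised algorithms with an oracle, and adaptivity -/

/-- A randomised algorithm that has access to an oracle `Q → ℝ` and returns a value in `α`. It may
stop, flip coins (which is free of oracle calls), or open a round: it then submits a finite batch
`qs` of queries, all fixed before any of them is answered, and continues with the answers. -/
inductive Alg (Q α : Type) : Type 1
  | output (a : α) : Alg Q α
  | sample {β : Type} (p : PMF β) (next : β → Alg Q α) : Alg Q α
  | round (qs : Finset Q) (next : (Q → ℝ) → Alg Q α) : Alg Q α

namespace Alg

variable {Q α β : Type}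

/-- Sequential composition. -/
def bind : Alg Q α → (α → Alg Q β) → Alg Q β
  | output a, k => k a
  | sample p next, k => sample p fun b => (next b).bind k
  | round qs next, k => round qs fun ans => (next ans).bind k

/-- The law of the output when the oracle is `F`. Only the values at the points queried are
revealed to the algorithm. -/
def run (F : Q → ℝ) : Alg Q α → PMF α
  | output a => PMF.pure a
  | sample p next => p.bind fun b => (next b).run F
  | round qs next => (next fun q => if q ∈ qs then F q else 0).run F

/-- The algorithm is `r`-adaptive with at most `b` queries in every round, all of them in `V`:
whatever the coins and the answers are, it opens at most `r` rounds. -/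
def IsAdaptive (V : Set Q) (b : ℕ) : Alg Q α → ℕ → Prop
  | output _, _ => True
  | sample p next, r => ∀ x ∈ p.support, (next x).IsAdaptive V b r
  | round _ _, 0 => False
  | round qs next, r + 1 =>
      qs.card ≤ b ∧ (∀ q ∈ qs, q ∈ V) ∧ ∀ ans : Q → ℝ, (next ans).IsAdaptive V b r

end Alg

variable {N : Type} [Fintype N]

/-! ### Submodular functions, matroids, the multilinear extension -/

/-- Diminishing marginal contributions. -/
def IsSubmodular (f : Finset N → ℝ) : Prop :=
  ∀ S T : Finset N, S ⊆ T → ∀ a, a ∉ T → f (insert a T) - f T ≤ f (insert a S) - f S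

/-- Non-negative monotone submodular functions `2^N → ℝ₊`. -/
def IsMonotoneSubmodular (f : Finset N → ℝ) : Prop :=
  (∀ S, 0 ≤ f S) ∧ Monotone f ∧ IsSubmodular f

/-- The independent sets of a matroid, as a set system on `N`. -/
def feasible (M : Matroid N) (S : Finset N) : Prop := M.Indep (S : Set N)

/-- The maximum size of a feasible set of a set system. -/
def rank (I : Finset N → Prop) : ℕ := (Finset.univ.filter I).sup Finset.card

/-- The largest value of `f` on a feasible set. -/
def opt (M : Matroid N) (f : Finset N → ℝ) : ℝ := sSup (f '' {S | feasible M S})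

/-- The indicator vector of a set. -/
def ind (S : Finset N) : N → ℝ := fun i => if i ∈ S then 1 else 0

/-- The cube `[0,1]^N`. -/
def cube : Set (N → ℝ) := {x | ∀ i, 0 ≤ x i ∧ x i ≤ 1}

/-- The matroid polytope. -/
def polytope (M : Matroid N) : Set (N → ℝ) := convexHull ℝ (ind '' {S | feasible M S})

/-- The multilinear extension: the expectation of `f R` for a random set `R` that contains each
`i` independently with probability `x i`. -/
def multilinear (f : Finset N → ℝ) (x : N → ℝ) : ℝ :=
  ∑ S : Finset N, ((∏ i ∈ S, x i) * ∏ i ∈ Sᶜ, (1 - x i)) * f S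

/-- The expectation of `f R` for `R` distributed according to `p`. -/
def expect (p : PMF (Finset N)) (f : Finset N → ℝ) : ℝ := ∑ S : Finset N, (p S).toReal * f S

/-- A randomised rounding of the points of the matroid polytope to feasible sets. It is one and
the same for all functions `f`, and in expectation it loses nothing. -/
def IsRounding (M : Matroid N) (ρ : (N → ℝ) → PMF (Finset N)) : Prop :=
  ∀ x ∈ polytope M, (∀ S ∈ (ρ x).support, feasible M S) ∧
    ∀ f : Finset N → ℝ, IsMonotoneSubmodular f → multilinear f x ≤ expect (ρ x) f

/-! ### Random feasible sequences -/

/-- The elements by which a sequence can be extended. -/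
def extensions (I : Finset N → Prop) (l : List N) : Finset N :=
  Finset.univ.filter fun a => a ∉ l ∧ I (insert a l.toFinset)

/-- Append an element chosen uniformly at random among the possible ones. -/
def extend (I : Finset N → Prop) (l : List N) : PMF (List N) :=
  if h : (extensions I l).Nonempty then
    (PMF.uniformOfFinset (extensions I l) h).map fun a => l ++ [a]
  else PMF.pure l

def randomPrefix (I : Finset N → Prop) : ℕ → PMF (List N)
  | 0 => PMF.pure []
  | i + 1 => (randomPrefix I i).bind (extend I)

/-- The procedure Random Sequence. -/
def randomSequence (I : Finset N → Prop) : PMF (List N) := randomPrefix I (rank I)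

/-! ### Adaptive Sequencing -/

/-- The set system `{T ⊆ X : S ∪ T ∈ I}`. -/
def residual (I : Finset N → Prop) (S X : Finset N) : Finset N → Prop :=
  fun T => T ⊆ X ∧ I (S ∪ T)

/-- `S ∪ {a₁, …, aᵢ}` for the sequence `l = (a₁, a₂, …)`. -/
def upTo (S : Finset N) (l : List N) (i : ℕ) : Finset N := S ∪ (l.take i).toFinset

/-- The elements of `X` that can be added to `A` and whose marginal contribution to `A` is at
least `t`. -/
def good (I : Finset N → Prop) (g : Finset N → ℝ) (t : ℝ) (X A : Finset N) : Finset N :=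
  X.filter fun a => a ∉ A ∧ I (insert a A) ∧ t ≤ g (insert a A) - g A

/-- The least position at which at most a `1 - ε` fraction of `X` is good. -/
def cutoff (I : Finset N → Prop) (g : Finset N → ℝ) (ε t : ℝ) (S X : Finset N) (l : List N) : ℕ :=
  sInf {i : ℕ | i ≤ l.length ∧ ((good I g t X (upTo S l i)).card : ℝ) ≤ (1 - ε) * X.card}

/-- The sets whose values determine all the marginal contributions along the sequence. -/
def queries (S X : Finset N) (l : List N) : Finset (Finset N) :=
  (Finset.range (l.length + 1)).biUnion fun i =>
    insert (upTo S l i) (X.image fun a => insert a (upTo S l i))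

/-- A random sequence cannot be extended any further. -/
theorem extensions_eq_empty {I : Finset N → Prop} {l : List N}
    (hl : l ∈ (randomSequence I).support) : extensions I l = ∅ := by
  have key : ∀ i (l : List N), l ∈ (randomPrefix I i).support →
      extensions I l = ∅ ∨ (l.Nodup ∧ l.length = i) := by
    intro i
    induction i with
    | zero =>
      intro l hl
      simp only [randomPrefix, PMF.mem_support_pure_iff] at hl
      subst hl
      right
      simp
    | succ i ih =>
      intro l hl
      simp only [randomPrefix, PMF.mem_support_bind_iff] at hl
      obtain ⟨l₀, h₀, h₁⟩ := hl
      unfold extend at h₁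
      split_ifs at h₁ with h
      · rw [PMF.mem_support_map_iff] at h₁
        obtain ⟨a, ha, rfl⟩ := h₁
        rw [PMF.mem_support_uniformOfFinset_iff] at ha
        have ha' : a ∉ l₀ := (Finset.mem_filter.1 ha).2.1
        rcases ih l₀ h₀ with h2 | ⟨h2, h3⟩
        · simp [h2] at h
        · right
          refine ⟨?_, by simp [h3]⟩
          rw [List.nodup_append]
          refine ⟨h2, by simp, ?_⟩
          intro b hb c hc hbc
          simp only [List.mem_singleton] at hc
          exact ha' (hc ▸ hbc ▸ hb)
      · rw [PMF.mem_support_pure_iff] at h₁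
        subst h₁
        left
        exact Finset.not_nonempty_iff_eq_empty.1 h
  rcases key _ l hl with h | ⟨h1, h2⟩
  · exact h
  · rw [Finset.eq_empty_iff_forall_notMem]
    intro a ha
    obtain ⟨-, ha1, ha2⟩ := Finset.mem_filter.1 ha
    have h3 : (insert a l.toFinset).card ≤ rank I :=
      Finset.le_sup (f := Finset.card) (Finset.mem_filter.2 ⟨Finset.mem_univ _, ha2⟩)
    rw [Finset.card_insert_of_notMem (by simpa using ha1), List.toFinset_card_of_nodup h1, h2] at h3
    omega

/-- The position `cutoff` always exists, and some element of `X` is discarded there. -/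
theorem card_good_cutoff_lt {I : Finset N → Prop} {g : Finset N → ℝ} {ε t : ℝ} {S X : Finset N}
    {l : List N} (hε : 0 < ε) (hε' : ε ≤ 1) (hX : X ≠ ∅)
    (hl : l ∈ (randomSequence (residual I S X)).support) :
    (good I g t X (upTo S l (cutoff I g ε t S X l))).card < X.card := by
  have hlX : ∀ i (l : List N), l ∈ (randomPrefix (residual I S X) i).support →
      l.toFinset ⊆ X := by
    intro i
    induction i with
    | zero =>
      intro l hl
      simp only [randomPrefix, PMF.mem_support_pure_iff] at hl
      subst hl
      simp
    | succ i ih =>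
      intro l hl
      simp only [randomPrefix, PMF.mem_support_bind_iff] at hl
      obtain ⟨l₀, h₀, h₁⟩ := hl
      unfold extend at h₁
      split_ifs at h₁ with h
      · rw [PMF.mem_support_map_iff] at h₁
        obtain ⟨a, ha, rfl⟩ := h₁
        rw [PMF.mem_support_uniformOfFinset_iff] at ha
        have ha' := (Finset.mem_filter.1 ha).2.2.1
        intro b hb
        apply ha'
        simpa [or_comm] using hb
      · rw [PMF.mem_support_pure_iff] at h₁
        subst h₁
        exact ih _ h₀
  have hsub := hlX _ l hl
  have hempty : good I g t X (upTo S l l.length) = ∅ := by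
    rw [Finset.eq_empty_iff_forall_notMem]
    intro a ha
    obtain ⟨haX, haA, haI, -⟩ := Finset.mem_filter.1 ha
    simp only [upTo, List.take_length] at haA haI
    have : a ∈ extensions (residual I S X) l := by
      refine Finset.mem_filter.2 ⟨Finset.mem_univ _, ?_, Finset.insert_subset haX hsub, ?_⟩
      · intro h
        exact haA (Finset.mem_union_right _ (by simpa using h))
      · rwa [Finset.union_insert]
    simp [extensions_eq_empty hl] at this
  have hne : {i : ℕ | i ≤ l.length ∧
      ((good I g t X (upTo S l i)).card : ℝ) ≤ (1 - ε) * X.card}.Nonempty := by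
    refine ⟨l.length, le_rfl, ?_⟩
    rw [hempty]
    simp only [Finset.card_empty, Nat.cast_zero]
    exact mul_nonneg (by linarith) (Nat.cast_nonneg _)
  have h := (Nat.sInf_mem hne).2
  have hpos : (0 : ℝ) < X.card := by
    exact_mod_cast Finset.card_pos.2 (Finset.nonempty_iff_ne_empty.2 hX)
  have : ((good I g t X (upTo S l (cutoff I g ε t S X l))).card : ℝ) < X.card := by
    refine lt_of_le_of_lt h ?_
    nlinarith
  exact_mod_cast this

/-- The inner loop `while X ≠ ∅`. The number argument only bounds the number of passes: a pass
removes at least one element from `X` (see `card_good_cutoff_lt`), so `|X|` passes always reach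
`X = ∅`. -/
def whileLoop (I : Finset N → Prop) (ε t : ℝ) :
    ℕ → Finset N → Finset N → Alg (Finset N) (Finset N)
  | 0, S, _ => .output S
  | fuel + 1, S, X =>
    if X = ∅ then .output S
    else .sample (randomSequence (residual I S X)) fun l =>
      .round (queries S X l) fun g =>
        whileLoop I ε t fuel (upTo S l (cutoff I g ε t S X l))
          (good I g t X (upTo S l (cutoff I g ε t S X l)))

/-- The outer loop, over decreasing thresholds `t`, starting with the current solution `S`. -/
def thresholdLoop (I : Finset N → Prop) (ε : ℝ) :
    ℕ → ℝ → Finset N → Alg (Finset N) (Finset N)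
  | 0, _, S => .output S
  | j + 1, t, S =>
    (whileLoop I ε t (Fintype.card N) S Finset.univ).bind fun S' =>
      thresholdLoop I ε j ((1 - ε) * t) S'

/-- The largest value of a feasible singleton. -/
def maxSingleton (I : Finset N → Prop) (g : Finset N → ℝ) : ℝ :=
  if h : (Finset.univ.filter fun a : N => I {a}).Nonempty then
    (Finset.univ.filter fun a : N => I {a}).sup' h fun a => g {a}
  else 0

/-- Adaptive Sequencing with `Δ` outer iterations. Its oracle returns values `g S`. -/
def adaptiveSequencing (I : Finset N → Prop) (ε : ℝ) (Δ : ℕ) : Alg (Finset N) (Finset N) :=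
  .round (Finset.univ.image fun a : N => {a}) fun g =>
    thresholdLoop I ε Δ (maxSingleton I g) ∅

/-! ### Accelerated Continuous Greedy -/

/-- Run an algorithm that expects an oracle for `g T = F (x + lam • 1_T) - F x` with the help of
an oracle for `F`, round by round. -/
def onStep (x : N → ℝ) (lam : ℝ) {α : Type} : Alg (Finset N) α → Alg (N → ℝ) α
  | .output a => .output a
  | .sample p next => .sample p fun b => onStep x lam (next b)
  | .round qs next => .round (insert x (qs.image fun T => x + lam • ind T)) fun ans =>
      onStep x lam (next fun T => if T ∈ qs then ans (x + lam • ind T) - ans x else 0)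

def greedyLoop (I : Finset N → Prop) (ε : ℝ) (Δ : ℕ) (lam : ℝ) :
    ℕ → (N → ℝ) → Alg (N → ℝ) (N → ℝ)
  | 0, x => .output x
  | j + 1, x => (onStep x lam (adaptiveSequencing I ε Δ)).bind fun S =>
      greedyLoop I ε Δ lam j (x + lam • ind S)

/-- The number `⌈ε⁻¹ log (k / (ε lam))⌉` of thresholds. -/
def numThresholds (k : ℕ) (ε lam : ℝ) : ℕ := ⌈Real.log (k / (ε * lam)) / ε⌉₊

/-- Accelerated Continuous Greedy with step size `1 / m`, that is, with `m` iterations. Its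
oracle returns values of the multilinear extension. -/
def acceleratedContinuousGreedy (M : Matroid N) (ε : ℝ) (m : ℕ) : Alg (N → ℝ) (N → ℝ) :=
  greedyLoop (feasible M) ε (numThresholds (rank (feasible M)) ε (1 / m)) (1 / m) m 0

/-- With an oracle for the multilinear extension `F` of `f`, the algorithm always returns a point
`x` of the matroid polytope, and with probability at least `1 - δ` both `F x` and the expected
value of the set to which `ρ` rounds `x` are at least `a` times the optimum. -/
def Approximates (A : Alg (N → ℝ) (N → ℝ)) (M : Matroid N) (ρ : (N → ℝ) → PMF (Finset N))
    (f : Finset N → ℝ) (a δ : ℝ) : Prop :=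
  (∀ x ∈ (A.run (multilinear f)).support, x ∈ polytope M) ∧
    ENNReal.ofReal (1 - δ) ≤ (A.run (multilinear f)).toOuterMeasure
      {x | a * opt M f ≤ multilinear f x ∧ a * opt M f ≤ expect (ρ x) f}

end Adaptive

end

open scoped Classical

noncomputable section

namespace Adaptive

open scoped ENNReal

set_option linter.unusedSectionVars false

variable {N : Type} [Fintype N]

/-! ### The multilinear extension -/

/-! Rounding is swap rounding. A point of the polytope is dominated by a convex combination of
bases. Two bases are merged by symmetric exchanges: each is a random move along a direction `e_i -
e_j` with mean displacement zero, and the multilinear extension `F` is convex along such directions.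
So no move lowers the expected value, and the law of the result does not depend on `f`
(`exists_isRounding`).

Adaptivity is a count. A pass of the inner loop shrinks `X` by the factor `1 - ε`, so there are
`O(log n / ε)` passes per threshold, `O(log (k / (ε lam)) / ε)` thresholds and `1 / lam` steps
(`exists_isAdaptive_acceleratedContinuousGreedy`).

For the value, let `s` be the sum of the bounds `t / (1 - ε)` on the feasible marginals over all
additions made by one run of Adaptive Sequencing (`Reached`). Before the cutoff a random extension
gains at least `t` with conditional probability at least `1 - ε`. Hence `exp (θ ((1 - ε)(1 - 2ε) s -
g S))` is a supermartingale while `θ t ≤ 1` (`mean_whileLoop_le`). Matroid augmentation pairs the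
elements of an optimal set `O` with those of `S`, so `s`, up to a truncation error, is at least
`lam` times the sum over `O` of the partial derivatives of `F` at the new point `y`
(`Reached.sum_le_add`), and therefore at least `lam (OPT - F y)`.

Together these give an implicit Euler step: with `κ = (1 - ε)(1 - 2ε)`, the gap `OPT - F` shrinks by
the factor `1 / (1 + κ lam)` up to a small error, in the sense of exponential moments
(`mean_adaptiveSequencing_step_le`). These moments multiply over the `m = 1 / lam` steps
(`mean_greedyLoop_le`). Since `(1 + κ / m) ^ (-m) ≤ 1 / e + O(ε)`, Markov's inequality with `θ = 1 /
(lam OPT)` loses only a further `lam log (1 / δ) OPT = O(ε) OPT`. -/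

/-- The discrete derivative of a set function in the direction of an element. -/
def marginal (i : N) (f : Finset N → ℝ) (S : Finset N) : ℝ := f (insert i S) - f (S.erase i)

theorem multilinear_eq_sum_erase (f : Finset N → ℝ) (x : N → ℝ) (i : N) :
    multilinear f x = ∑ S ∈ (Finset.univ.erase i).powerset,
      ((∏ j ∈ S, x j) * ∏ j ∈ Finset.univ.erase i \ S, (1 - x j)) *
        ((1 - x i) * f S + x i * f (insert i S)) := by
  have h0 : (Finset.univ : Finset (Finset N)) = (insert i (Finset.univ.erase i)).powerset := by
    rw [Finset.insert_erase (Finset.mem_univ i), Finset.powerset_univ]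
  unfold multilinear
  rw [h0, Finset.sum_powerset_insert (Finset.notMem_erase i _), ← Finset.sum_add_distrib]
  refine Finset.sum_congr rfl fun S hS => ?_
  have hi : i ∉ S := fun h => Finset.notMem_erase i _ (Finset.mem_powerset.1 hS h)
  have h1 : Sᶜ = insert i (Finset.univ.erase i \ S) := by
    ext j
    by_cases hj : j = i <;> simp [hj, hi]
  have h2 : (insert i S)ᶜ = Finset.univ.erase i \ S := by
    ext j
    simp
  rw [h2, Finset.prod_insert hi, h1, Finset.prod_insert (by simp)]
  ring

/-- `F` is affine in each coordinate, with slope the extension of the discrete derivative.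
Monotonicity, decreasing gradients and convexity along exchanges are all read off from this
identity. -/
theorem multilinear_update (f : Finset N → ℝ) (x : N → ℝ) (i : N) (v : ℝ) :
    multilinear f (Function.update x i v) =
      multilinear f x + (v - x i) * multilinear (marginal i f) x := by
  rw [multilinear_eq_sum_erase f _ i, multilinear_eq_sum_erase f x i,
    multilinear_eq_sum_erase _ x i, Finset.mul_sum, ← Finset.sum_add_distrib]
  refine Finset.sum_congr rfl fun S hS => ?_
  have hi : i ∉ S := fun h => Finset.notMem_erase i _ (Finset.mem_powerset.1 hS h)
  have h1 : ∏ j ∈ S, Function.update x i v j = ∏ j ∈ S, x j :=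
    Finset.prod_congr rfl fun j hj => by
      rw [Function.update_of_ne]
      rintro rfl
      exact hi hj
  have h2 : ∏ j ∈ Finset.univ.erase i \ S, (1 - Function.update x i v j) =
      ∏ j ∈ Finset.univ.erase i \ S, (1 - x j) :=
    Finset.prod_congr rfl fun j hj => by
      rw [Function.update_of_ne]
      rintro rfl
      simp at hj
  rw [h1, h2, Function.update_self]
  simp only [marginal, Finset.insert_idem, Finset.erase_insert hi, Finset.erase_eq_of_notMem hi]
  ring

theorem multilinear_neg (f : Finset N → ℝ) (x : N → ℝ) :
    multilinear (fun S => -f S) x = -multilinear f x := by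
  simp [multilinear]

theorem multilinear_nonneg {f : Finset N → ℝ} (hf : ∀ S, 0 ≤ f S) {x : N → ℝ} (hx : x ∈ cube) :
    0 ≤ multilinear f x :=
  Finset.sum_nonneg fun S _ => mul_nonneg
    (mul_nonneg (Finset.prod_nonneg fun i _ => (hx i).1)
      (Finset.prod_nonneg fun i _ => by linarith [(hx i).2])) (hf S)

theorem multilinear_ind (f : Finset N → ℝ) (S : Finset N) : multilinear f (ind S) = f S := by
  unfold multilinear
  rw [Finset.sum_eq_single S]
  · have h1 : ∏ i ∈ S, ind S i = 1 := Finset.prod_eq_one fun i hi => by simp [ind, hi]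
    have h2 : ∏ i ∈ Sᶜ, (1 - ind S i) = 1 :=
      Finset.prod_eq_one fun i hi => by simp [ind, Finset.mem_compl.1 hi]
    rw [h1, h2]
    ring
  · intro T _ hT
    have : (∏ i ∈ T, ind S i) * ∏ i ∈ Tᶜ, (1 - ind S i) = 0 := by
      by_cases h : T ⊆ S
      · obtain ⟨i, hiS, hiT⟩ := Finset.exists_of_ssubset (lt_of_le_of_ne h hT)
        rw [Finset.prod_eq_zero (i := i) (s := Tᶜ) (by simpa using hiT) (by simp [ind, hiS]),
          mul_zero]
      · obtain ⟨i, hiT, hiS⟩ := Finset.not_subset.1 h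
        rw [Finset.prod_eq_zero (i := i) (s := T) hiT (by simp [ind, hiS]), zero_mul]
    rw [this, zero_mul]
  · simp

theorem ind_mem_cube (S : Finset N) : ind S ∈ cube := by
  intro i
  by_cases h : i ∈ S <;> simp [ind, h]

theorem piecewise_mem_cube {x y : N → ℝ} (hx : x ∈ cube) (hy : y ∈ cube) (T : Finset N) :
    T.piecewise x y ∈ cube := by
  intro i
  by_cases h : i ∈ T
  · simpa [h] using hx i
  · simpa [h] using hy i

theorem marginal_nonneg {f : Finset N → ℝ} (hf : Monotone f) (i : N) (S : Finset N) :
    0 ≤ marginal i f S :=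
  sub_nonneg.2 (hf ((Finset.erase_subset _ _).trans (Finset.subset_insert _ _)))

theorem marginal_antitone {f : Finset N → ℝ} (hf : IsSubmodular f) (i : N) :
    Antitone (marginal i f) := by
  intro S T hST
  have h := hf (S.erase i) (T.erase i) (Finset.erase_subset_erase i hST) i (Finset.notMem_erase i T)
  have e : ∀ U : Finset N, insert i (U.erase i) = insert i U := fun U => by
    ext j
    by_cases hj : j = i <;> simp [hj]
  rw [e, e] at h
  exact h

theorem multilinear_mono {f : Finset N → ℝ} (hf : Monotone f) {x y : N → ℝ} (hx : x ∈ cube)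
    (hy : y ∈ cube) (hxy : x ≤ y) : multilinear f x ≤ multilinear f y := by
  have key : ∀ T : Finset N, multilinear f x ≤ multilinear f (T.piecewise y x) := by
    intro T
    induction T using Finset.induction_on with
    | empty => simp
    | insert i T hi ih =>
      rw [Finset.piecewise_insert, multilinear_update, Finset.piecewise_eq_of_notMem _ _ _ hi]
      have := multilinear_nonneg (marginal_nonneg hf i) (piecewise_mem_cube hy hx T)
      nlinarith [hxy i]
  simpa using key Finset.univ

theorem multilinear_anti {f : Finset N → ℝ} (hf : Antitone f) {x y : N → ℝ} (hx : x ∈ cube)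
    (hy : y ∈ cube) (hxy : x ≤ y) : multilinear f y ≤ multilinear f x := by
  have := multilinear_mono (f := fun S => -f S) (fun S T h => neg_le_neg (hf h)) hx hy hxy
  rw [multilinear_neg, multilinear_neg] at this
  linarith

/-- The coordinates in `O` are raised to `1` one at a time. Each rises by at most `1`, the slopes
only fall on the way, and the final point dominates the indicator of `O`. -/
theorem le_multilinear_add_sum_marginal {f : Finset N → ℝ} (hf : Monotone f)
    (hf' : IsSubmodular f) {y : N → ℝ} (hy : y ∈ cube) (O : Finset N) :
    f O ≤ multilinear f y + ∑ o ∈ O, multilinear (marginal o f) y := by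
  have h1 : (1 : N → ℝ) ∈ cube := fun i => by simp
  have key : ∀ T : Finset N, multilinear f (T.piecewise 1 y) ≤
      multilinear f y + ∑ o ∈ T, multilinear (marginal o f) y := by
    intro T
    induction T using Finset.induction_on with
    | empty => simp
    | insert i T hi ih =>
      have hz := piecewise_mem_cube h1 hy T
      rw [Finset.piecewise_insert, multilinear_update, Finset.piecewise_eq_of_notMem _ _ _ hi,
        Finset.sum_insert hi, Pi.one_apply]
      have h2 := multilinear_nonneg (marginal_nonneg hf i) hz
      have h3 : multilinear (marginal i f) (T.piecewise 1 y) ≤ multilinear (marginal i f) y :=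
        multilinear_anti (marginal_antitone hf' i) hy hz fun j => by
          by_cases hj : j ∈ T
          · simpa [hj] using (hy j).2
          · simp [hj]
      nlinarith [(hy i).1]
  calc f O = multilinear f (ind O) := (multilinear_ind f O).symm
    _ ≤ multilinear f (O.piecewise 1 y) :=
      multilinear_mono hf (ind_mem_cube O) (piecewise_mem_cube h1 hy O) fun j => by
        by_cases hj : j ∈ O
        · simp [ind, hj]
        · simpa [ind, hj] using (hy j).1
    _ ≤ _ := key O

/-- Along an exchange direction the multilinear extension of a submodular function is convex. -/
theorem multilinear_add_single_sub_single {f : Finset N → ℝ} (hf : IsSubmodular f) {x : N → ℝ}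
    (hx : x ∈ cube) {i j : N} (hij : i ≠ j) : ∃ D A : ℝ, 0 ≤ A ∧ ∀ t : ℝ,
      multilinear f (x + t • (Pi.single i 1 - Pi.single j 1)) =
        multilinear f x + t * D + t ^ 2 * A := by
  refine ⟨multilinear (marginal i f) x - multilinear (marginal j f) x,
    multilinear (fun S => -marginal i (marginal j f) S) x, multilinear_nonneg (fun S => ?_) hx,
    fun t => ?_⟩
  · have := marginal_antitone hf j
      ((Finset.erase_subset i S).trans (Finset.subset_insert i S))
    have h : marginal i (marginal j f) S ≤ 0 := sub_nonpos.2 this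
    linarith
  · have e : x + t • (Pi.single i 1 - Pi.single j 1) =
        Function.update (Function.update x i (x i + t)) j (x j - t) := by
      ext l
      by_cases hj : l = j
      · subst hj
        simp [Pi.single_eq_of_ne hij.symm]
        ring
      · by_cases hi : l = i
        · subst hi
          simp [hj]
        · simp [hj, hi]
    rw [e, multilinear_update, multilinear_update, multilinear_update,
      Function.update_of_ne hij.symm, multilinear_neg]
    ring

/-! ### Swap rounding -/

/-- Let `C` be the fundamental circuit of `i` in `B`. If `C \ {i}` lay in the closure of `A \ {i}`,
so would `i`, against the independence of `A`. Any `j` in `C \ {i}` outside that closure works on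
both sides. -/
theorem exists_symmetric_exchange {M : Matroid N} {A B : Finset N} (hA : M.IsBase (A : Set N))
    (hB : M.IsBase (B : Set N)) {i : N} (hi : i ∈ A \ B) :
    ∃ j ∈ B \ A, M.IsBase ((insert j (A.erase i) : Finset N) : Set N) ∧
      M.IsBase ((insert i (B.erase j) : Finset N) : Set N) := by
  obtain ⟨hiA, hiB⟩ := Finset.mem_sdiff.1 hi
  have hiE : i ∈ M.E := hA.subset_ground hiA
  have hC := hB.fundCircuit_isCircuit hiE (by simpa using hiB)
  have hnot : ¬ M.fundCircuit i B \ {i} ⊆ M.closure ((A : Set N) \ {i}) := fun h =>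
    hA.indep.notMem_closure_sdiff_of_mem (by simpa using hiA)
      (M.closure_subset_closure_of_subset_closure h
        (hC.mem_closure_sdiff_singleton_of_mem (M.mem_fundCircuit i B)))
  obtain ⟨j, ⟨hjC, hji⟩, hjcl⟩ := Set.not_subset.1 hnot
  have hji' : j ≠ i := hji
  have hjB : j ∈ B := by
    rcases M.fundCircuit_subset_insert i B hjC with h | h
    · exact absurd h hji
    · exact h
  have hjA : j ∉ A := fun h => hjcl
    (M.mem_closure_of_mem ⟨h, hji⟩ (Set.sdiff_subset.trans hA.subset_ground))
  refine ⟨j, by simp [hjB, hjA], ?_, ?_⟩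
  · have := hA.exchange_base_of_notMem_closure (e := i) (f := j) (by simpa using hiA) hjcl
      (hB.subset_ground hjB)
    simpa using this
  · have hicl : i ∈ M.closure (B : Set N) := by rwa [hB.closure_eq]
    have := hB.exchange_isBase_of_indep' (e := j) (f := i) hjB (by simpa using hiB)
      ((hB.indep.mem_fundCircuit_iff hicl (by simpa using hiB)).1 hjC)
    rw [← Set.insert_sdiff_singleton_comm hji'.symm] at this
    simpa using this

/-- Some random feasible set is, in expectation, at least as good as `x` for all non-negative
monotone submodular functions. -/
def Roundable (M : Matroid N) (x : N → ℝ) : Prop :=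
  ∃ w : Finset N → ℝ, (∀ S, 0 ≤ w S) ∧ ∑ S, w S = 1 ∧ (∀ S, w S ≠ 0 → feasible M S) ∧
    ∀ f, IsMonotoneSubmodular f → multilinear f x ≤ ∑ S, w S * f S

theorem roundable_ind {M : Matroid N} {S : Finset N} (hS : feasible M S) :
    Roundable M (ind S) := by
  refine ⟨fun T => if T = S then 1 else 0, fun T => by dsimp only; split_ifs <;> norm_num, by simp,
    fun T hT => ?_, fun f _ => by simp [multilinear_ind]⟩
  by_cases h : T = S
  · rwa [h]
  · simp [h] at hT

theorem Roundable.mono {M : Matroid N} {x y : N → ℝ} (h : Roundable M y) (hx : x ∈ cube)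
    (hy : y ∈ cube) (hxy : x ≤ y) : Roundable M x := by
  obtain ⟨w, h0, h1, h2, h3⟩ := h
  exact ⟨w, h0, h1, h2, fun f hf => (multilinear_mono hf.2.1 hx hy hxy).trans (h3 f hf)⟩

theorem Roundable.combine {M : Matroid N} {x y z : N → ℝ} (hx : Roundable M x)
    (hy : Roundable M y) {p q : ℝ} (hp : 0 ≤ p) (hq : 0 ≤ q) (hpq : p + q = 1)
    (h : ∀ f, IsMonotoneSubmodular f →
      multilinear f z ≤ p * multilinear f x + q * multilinear f y) : Roundable M z := by
  obtain ⟨v, v0, v1, v2, v3⟩ := hx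
  obtain ⟨w, w0, w1, w2, w3⟩ := hy
  refine ⟨fun S => p * v S + q * w S,
    fun S => add_nonneg (mul_nonneg hp (v0 S)) (mul_nonneg hq (w0 S)), ?_, fun S hS => ?_,
    fun f hf => (h f hf).trans ?_⟩
  · rw [Finset.sum_add_distrib, ← Finset.mul_sum, ← Finset.mul_sum, v1, w1, mul_one, mul_one, hpq]
  · by_contra hc
    apply hS
    dsimp only
    rw [not_not.1 fun hv => hc (v2 S hv), not_not.1 fun hw => hc (w2 S hw)]
    simp
  · have : ∑ S, (p * v S + q * w S) * f S = p * ∑ S, v S * f S + q * ∑ S, w S * f S := by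
      rw [Finset.mul_sum, Finset.mul_sum, ← Finset.sum_add_distrib]
      exact Finset.sum_congr rfl fun S _ => by ring
    rw [this]
    exact add_le_add (mul_le_mul_of_nonneg_left (v3 f hf) hp)
      (mul_le_mul_of_nonneg_left (w3 f hf) hq)

theorem ind_exchange {B : Finset N} {i j : N} (hi : i ∈ B) (hj : j ∉ B) :
    ind (insert j (B.erase i)) = ind B + (Pi.single j 1 - Pi.single i 1) := by
  have hij : i ≠ j := fun h => hj (h ▸ hi)
  ext l
  by_cases h1 : l = j
  · subst h1
    simp [ind, hj, Pi.single_eq_of_ne hij.symm]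
  · by_cases h2 : l = i
    · subst h2
      simp [ind, hi, h1]
    · simp [ind, h1, h2]

theorem add_smul_ind_mem_cube {z : N → ℝ} {a b : ℝ} (ha : 0 ≤ a) (hb : 0 ≤ b)
    (hz : ∀ i, 0 ≤ z i ∧ z i + (a + b) ≤ 1) (A B : Finset N) :
    z + a • ind A + b • ind B ∈ cube := by
  intro i
  have h1 := ind_mem_cube A i
  have h2 := ind_mem_cube B i
  simp only [Pi.add_apply, Pi.smul_apply, smul_eq_mul]
  have h3 := hz i
  constructor
  · have := mul_nonneg ha h1.1
    have := mul_nonneg hb h2.1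
    linarith
  · nlinarith

/-- Backward form of merging two bases: roundability is known once they coincide, and each exchange,
on either side, reduces `|A \ B|` by one. -/
theorem roundable_merge {M : Matroid N} {z : N → ℝ} {a b : ℝ} (ha : 0 ≤ a) (hb : 0 ≤ b)
    (hab : 0 < a + b) (hz : ∀ i, 0 ≤ z i ∧ z i + (a + b) ≤ 1)
    (h : ∀ B : Finset N, M.IsBase (B : Set N) → Roundable M (z + (a + b) • ind B)) :
    ∀ (n : ℕ) (A B : Finset N), M.IsBase (A : Set N) → M.IsBase (B : Set N) →
      (A \ B).card = n → Roundable M (z + a • ind A + b • ind B) := by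
  intro n
  induction n with
  | zero =>
    intro A B hA hB hn
    have hAB : A = B := by
      have := hA.eq_of_subset_isBase hB
        (by simpa using Finset.sdiff_eq_empty_iff_subset.1 (Finset.card_eq_zero.1 hn))
      exact_mod_cast this
    subst hAB
    rw [add_assoc, ← add_smul]
    exact h A hA
  | succ n ih =>
    intro A B hA hB hn
    obtain ⟨i, hi⟩ := Finset.card_pos.1 (by omega : 0 < (A \ B).card)
    obtain ⟨j, hj, hA', hB'⟩ := exists_symmetric_exchange hA hB hi
    obtain ⟨hiA, hiB⟩ := Finset.mem_sdiff.1 hi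
    obtain ⟨hjB, hjA⟩ := Finset.mem_sdiff.1 hj
    have hij : i ≠ j := fun h => hjA (h ▸ hiA)
    have c1 : (insert j (A.erase i) \ B).card = n := by
      have : insert j (A.erase i) \ B = (A \ B).erase i := by
        ext l
        by_cases h : l = j <;> simp [h, hjB, hjA, and_assoc]
      rw [this, Finset.card_erase_of_mem hi, hn]
      rfl
    have c2 : (A \ insert i (B.erase j)).card = n := by
      have : A \ insert i (B.erase j) = (A \ B).erase i := by
        ext l
        by_cases h : l = j
        · simp [h, hjA]
        · simp [h]
          tauto
      rw [this, Finset.card_erase_of_mem hi, hn]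
      rfl
    have hx := add_smul_ind_mem_cube ha hb hz A B
    -- The two outcomes lie at `b` and `-a` along `e_i - e_j`. The weights `a / (a + b)` and `b / (a
    -- + b)` cancel the linear term and leave `a b E ≥ 0`.
    refine (ih A _ hA hB' c2).combine (ih _ B hA' hB c1) (p := a / (a + b)) (q := b / (a + b))
      (by positivity) (by positivity) (by field_simp) fun f hf => ?_
    obtain ⟨D, E, hE, hD⟩ := multilinear_add_single_sub_single hf.2.2 hx hij
    have e1 : z + a • ind A + b • ind (insert i (B.erase j)) =
        z + a • ind A + b • ind B + b • (Pi.single i 1 - Pi.single j 1) := by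
      rw [ind_exchange hjB hiB, smul_add, ← add_assoc]
    have e2 : z + a • ind (insert j (A.erase i)) + b • ind B =
        z + a • ind A + b • ind B + (-a) • (Pi.single i 1 - Pi.single j 1) := by
      rw [ind_exchange hiA hjA]
      module
    rw [e1, e2, hD, hD]
    set F := multilinear f (z + a • ind A + b • ind B)
    have : a / (a + b) * (F + b * D + b ^ 2 * E) + b / (a + b) * (F + -a * D + (-a) ^ 2 * E) =
        F + a * b * E := by
      field_simp
      ring
    rw [this]
    have := mul_nonneg (mul_nonneg ha hb) hE
    linarith

/-- The share of one base is moved into the fixed part `z`. What is then needed, for a single base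
carrying the remaining weight, is a merge of two bases. -/
theorem roundable_sum {M : Matroid N} {ι : Type*} (B : ι → Finset N)
    (hB : ∀ l, M.IsBase (B l : Set N)) {w : ι → ℝ} (T : Finset ι) :
    (∀ l ∈ T, 0 ≤ w l) → ∀ z : N → ℝ, (∀ i, 0 ≤ z i ∧ z i + ∑ l ∈ T, w l ≤ 1) →
    (∀ A : Finset N, M.IsBase (A : Set N) → Roundable M (z + (∑ l ∈ T, w l) • ind A)) →
    Roundable M (z + ∑ l ∈ T, w l • ind (B l)) := by
  induction T using Finset.induction_on with
  | empty =>
    intro _ z _ h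
    obtain ⟨A, hA⟩ := M.exists_isBase
    simpa using h A.toFinset (by simpa using hA)
  | insert l T hl ih =>
    intro hw z hz h
    have hl0 : 0 ≤ w l := hw l (Finset.mem_insert_self l T)
    have hT0 : 0 ≤ ∑ l ∈ T, w l :=
      Finset.sum_nonneg fun l hl => hw l (Finset.mem_insert_of_mem hl)
    rw [Finset.sum_insert hl] at hz h
    rw [Finset.sum_insert hl, ← add_assoc]
    refine ih (fun l hl => hw l (Finset.mem_insert_of_mem hl)) _ (fun i => ?_) fun A hA => ?_
    · have h1 := ind_mem_cube (B l) i
      have h2 := hz i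
      simp only [Pi.add_apply, Pi.smul_apply, smul_eq_mul]
      constructor <;> nlinarith
    · rcases (add_nonneg hl0 hT0).eq_or_lt with h0 | h0
      · have h1 : w l = 0 := by linarith
        have h2 : ∑ l ∈ T, w l = 0 := by linarith
        simpa [h1, h2] using h A hA
      · exact roundable_merge hl0 hT0 h0 hz h _ (B l) A (hB l) hA rfl

theorem polytope_subset_cube (M : Matroid N) : polytope M ⊆ cube := by
  refine convexHull_min ?_ ?_
  · rintro _ ⟨S, -, rfl⟩
    exact ind_mem_cube S
  · have : (cube : Set (N → ℝ)) = Set.Icc 0 1 := by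
      ext x
      simp only [cube, Set.mem_ofPred_eq, Set.mem_Icc, Pi.le_def, ← forall_and]
      rfl
    rw [this]
    exact convex_Icc 0 1

theorem roundable_of_mem_polytope {M : Matroid N} {x : N → ℝ} (hx : x ∈ polytope M) :
    Roundable M x := by
  have hx' := hx
  rw [polytope, convexHull_eq] at hx'
  obtain ⟨ι, T, w, y, hw, hw1, hy, rfl⟩ := hx'
  rw [Finset.centerMass_eq_of_sum_1 _ _ hw1] at hx ⊢
  -- Exchanges need bases, so the independent sets are enlarged. This only raises the point, which
  -- `Roundable.mono` permits.
  have hB : ∀ l : ι, ∃ B : Finset N, M.IsBase (B : Set N) ∧ (l ∈ T → y l ≤ ind B) := by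
    intro l
    by_cases hl : l ∈ T
    · obtain ⟨S, hS, hSy⟩ := hy l hl
      obtain ⟨B, hB, hSB⟩ := Matroid.Indep.exists_isBase_superset hS
      refine ⟨B.toFinset, by simpa using hB, fun _ i => ?_⟩
      rw [← hSy]
      by_cases hi : i ∈ S
      · simp [ind, hi, hSB (Finset.mem_coe.2 hi)]
      · simpa [ind, hi] using (ind_mem_cube B.toFinset i).1
    · obtain ⟨B, hB⟩ := M.exists_isBase
      exact ⟨B.toFinset, by simpa using hB, fun h => absurd h hl⟩
  choose B hB hyB using hB
  have hr := roundable_sum B hB T hw 0 (fun i => by simp [hw1]) fun A hA => by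
    rw [hw1, one_smul, zero_add]
    exact roundable_ind hA.indep
  rw [zero_add] at hr
  refine hr.mono (polytope_subset_cube M hx) ?_ ?_
  · intro i
    simp only [Finset.sum_apply, Pi.smul_apply, smul_eq_mul]
    refine ⟨Finset.sum_nonneg fun l hl => mul_nonneg (hw l hl) (ind_mem_cube _ i).1, ?_⟩
    rw [← hw1]
    exact Finset.sum_le_sum fun l hl =>
      mul_le_of_le_one_right (hw l hl) (ind_mem_cube _ i).2
  · exact Finset.sum_le_sum fun l hl => smul_le_smul_of_nonneg_left (hyB l hl) (hw l hl)

theorem exists_isRounding (M : Matroid N) : ∃ ρ, IsRounding M ρ := by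
  have key : ∀ x : N → ℝ, ∃ p : PMF (Finset N), x ∈ polytope M →
      (∀ S ∈ p.support, feasible M S) ∧
        ∀ f : Finset N → ℝ, IsMonotoneSubmodular f → multilinear f x ≤ expect p f := by
    intro x
    by_cases hx : x ∈ polytope M
    · obtain ⟨w, h0, h1, h2, h3⟩ := roundable_of_mem_polytope hx
      refine ⟨PMF.ofFintype (fun S => ENNReal.ofReal (w S)) ?_, fun _ => ⟨fun S hS => ?_, ?_⟩⟩
      · rw [← ENNReal.ofReal_sum_of_nonneg fun S _ => h0 S, h1, ENNReal.ofReal_one]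
      · rw [PMF.mem_support_ofFintype_iff] at hS
        refine h2 S fun h => hS ?_
        rw [h, ENNReal.ofReal_zero]
      · intro f hf
        refine (h3 f hf).trans (le_of_eq ?_)
        simp only [expect, PMF.ofFintype_apply, ENNReal.toReal_ofReal (h0 _)]
    · exact ⟨PMF.pure ∅, fun h => absurd h hx⟩
  choose ρ hρ using key
  exact ⟨ρ, fun x hx => hρ x hx⟩

/-! ### Expectations -/

/-- The expectation of a function with values in `[0, ∞]`. -/
def mean {α : Type*} (p : PMF α) (φ : α → ℝ≥0∞) : ℝ≥0∞ := ∑' a, p a * φ a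

section mean

variable {α β : Type*}

theorem mean_pure (a : α) (φ : α → ℝ≥0∞) : mean (PMF.pure a) φ = φ a := by
  unfold mean
  rw [tsum_eq_single a fun b hb => by rw [PMF.pure_apply_of_ne _ _ hb, zero_mul],
    PMF.pure_apply_self, one_mul]

theorem mean_bind (p : PMF α) (k : α → PMF β) (φ : β → ℝ≥0∞) :
    mean (p.bind k) φ = mean p fun a => mean (k a) φ := by
  simp only [mean, PMF.bind_apply, ← ENNReal.tsum_mul_right, ← ENNReal.tsum_mul_left]
  rw [ENNReal.tsum_comm]
  simp only [mul_assoc]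

theorem mean_map (p : PMF α) (k : α → β) (φ : β → ℝ≥0∞) :
    mean (p.map k) φ = mean p fun a => φ (k a) := by
  rw [← PMF.bind_pure_comp, mean_bind]
  simp only [Function.comp_apply, mean_pure]

theorem mean_mono {p : PMF α} {φ ψ : α → ℝ≥0∞} (h : ∀ a ∈ p.support, φ a ≤ ψ a) :
    mean p φ ≤ mean p ψ :=
  ENNReal.tsum_le_tsum fun a => by
    by_cases ha : a ∈ p.support
    · gcongr
      exact h a ha
    · rw [(PMF.apply_eq_zero_iff p a).2 ha, zero_mul, zero_mul]

theorem mean_const (p : PMF α) (c : ℝ≥0∞) : mean p (fun _ => c) = c := by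
  rw [mean, ENNReal.tsum_mul_right, PMF.tsum_coe, one_mul]

theorem mean_const_mul (p : PMF α) (c : ℝ≥0∞) (φ : α → ℝ≥0∞) :
    mean p (fun a => c * φ a) = c * mean p φ := by
  rw [mean, mean, ← ENNReal.tsum_mul_left]
  exact tsum_congr fun a => mul_left_comm _ _ _

theorem mean_uniformOfFinset_le {s : Finset α} (hs : s.Nonempty) {h : α → ℝ} {c : ℝ}
    (h0 : ∀ a ∈ s, 0 ≤ h a) (hc : ∑ a ∈ s, h a ≤ s.card * c) :
    mean (PMF.uniformOfFinset s hs) (fun a => ENNReal.ofReal (h a)) ≤ ENNReal.ofReal c := by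
  unfold mean
  rw [tsum_eq_sum (s := s) fun a ha => by
    rw [PMF.uniformOfFinset_apply_of_notMem hs ha, zero_mul]]
  rw [Finset.sum_congr rfl fun a ha => by rw [PMF.uniformOfFinset_apply_of_mem hs ha],
    ← Finset.mul_sum, ← ENNReal.ofReal_sum_of_nonneg h0]
  refine (mul_le_mul_right (ENNReal.ofReal_le_ofReal hc) _).trans (le_of_eq ?_)
  rw [ENNReal.ofReal_mul (Nat.cast_nonneg _), ENNReal.ofReal_natCast, ← mul_assoc,
    ENNReal.inv_mul_cancel (by simpa using hs.ne_empty) (ENNReal.natCast_ne_top _), one_mul]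

/-- Markov's inequality. -/
theorem mul_toOuterMeasure_le_mean (p : PMF α) (φ : α → ℝ≥0∞) (c : ℝ≥0∞) :
    c * p.toOuterMeasure {a | c ≤ φ a} ≤ mean p φ := by
  rw [PMF.toOuterMeasure_apply, ← ENNReal.tsum_mul_left]
  refine ENNReal.tsum_le_tsum fun a => ?_
  by_cases h : c ≤ φ a
  · rw [Set.indicator_of_mem (by exact h), mul_comm]
    gcongr
  · rw [Set.indicator_of_notMem (by exact h), mul_zero]
    exact zero_le

/-- If `φ` has mean at most `δ c`, then an event that contains `φ < c` has probability at least
`1 - δ`. -/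
theorem ofReal_one_sub_le_toOuterMeasure {p : PMF α} {φ : α → ℝ≥0∞} {c : ℝ≥0∞} {δ : ℝ}
    (hc : c ≠ 0) (hc' : c ≠ ∞) (hδ : 0 ≤ δ) (h : mean p φ ≤ c * ENNReal.ofReal δ) {E : Set α}
    (hE : ∀ a ∈ p.support, φ a < c → a ∈ E) :
    ENNReal.ofReal (1 - δ) ≤ p.toOuterMeasure E := by
  have h1 : p.toOuterMeasure {a | c ≤ φ a} ≤ ENNReal.ofReal δ :=
    (ENNReal.mul_le_mul_iff_right hc hc').1 ((mul_toOuterMeasure_le_mean p φ c).trans h)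
  have h2 : (1 : ℝ≥0∞) ≤ p.toOuterMeasure E + ENNReal.ofReal δ := by
    calc (1 : ℝ≥0∞) = p.toOuterMeasure Set.univ :=
          ((PMF.toOuterMeasure_apply_eq_one_iff p Set.univ).2 (Set.subset_univ _)).symm
      _ ≤ p.toOuterMeasure (E ∪ {a | c ≤ φ a}) := PMF.toOuterMeasure_mono p fun a ha => by
          by_cases hca : c ≤ φ a
          · exact Or.inr hca
          · exact Or.inl (hE a ha.2 (not_le.1 hca))
      _ ≤ p.toOuterMeasure E + p.toOuterMeasure {a | c ≤ φ a} :=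
          MeasureTheory.measure_union_le _ _
      _ ≤ _ := by gcongr
  rw [ENNReal.ofReal_sub _ hδ, ENNReal.ofReal_one]
  exact tsub_le_iff_right.2 h2

end mean

/-! ### Runs and adaptivity of composed algorithms -/

namespace Alg

variable {Q α β : Type}

theorem run_bind (F : Q → ℝ) (A : Alg Q α) (k : α → Alg Q β) :
    (A.bind k).run F = (A.run F).bind fun a => (k a).run F := by
  induction A with
  | output a => simp [Alg.bind, run]
  | sample p next ih => simp [Alg.bind, run, ih, PMF.bind_bind]
  | round qs next ih => simp [Alg.bind, run, ih]

theorem IsAdaptive.mono {V : Set Q} {b : ℕ} {A : Alg Q α} :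
    ∀ {r r' : ℕ}, A.IsAdaptive V b r → r ≤ r' → A.IsAdaptive V b r' := by
  induction A with
  | output a => intros; trivial
  | sample p next ih => exact fun h hr x hx => ih x (h x hx) hr
  | round qs next ih =>
    intro r r' h hr
    cases r with
    | zero => exact h.elim
    | succ r =>
      cases r' with
      | zero => omega
      | succ r' => exact ⟨h.1, h.2.1, fun ans => ih _ (h.2.2 ans) (by omega)⟩

theorem IsAdaptive.bind {V : Set Q} {b : ℕ} {A : Alg Q α} {k : α → Alg Q β} {r' : ℕ}
    (hk : ∀ a, (k a).IsAdaptive V b r') :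
    ∀ {r : ℕ}, A.IsAdaptive V b r → (A.bind k).IsAdaptive V b (r + r') := by
  induction A with
  | output a => exact fun _ => (hk a).mono (Nat.le_add_left _ _)
  | sample p next ih => exact fun h x hx => ih x (h x hx)
  | round qs next ih =>
    intro r h
    cases r with
    | zero => exact h.elim
    | succ r =>
      rw [Nat.add_right_comm]
      exact ⟨h.1, h.2.1, fun ans => ih _ (h.2.2 ans)⟩

end Alg

theorem run_onStep (F : (N → ℝ) → ℝ) (x : N → ℝ) (lam : ℝ) {α : Type} (A : Alg (Finset N) α) :
    (onStep x lam A).run F = A.run fun T => F (x + lam • ind T) - F x := by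
  induction A with
  | output a => rfl
  | sample p next ih => simp only [onStep, Alg.run, ih]
  | round qs next ih =>
    simp only [onStep, Alg.run, ih]
    congr 2
    ext T
    by_cases hT : T ∈ qs
    · have : x + lam • ind T ∈ insert x (qs.image fun T => x + lam • ind T) :=
        Finset.mem_insert_of_mem (Finset.mem_image_of_mem _ hT)
      simp [hT, this]
    · simp [hT]

theorem Alg.IsAdaptive.onStep {x : N → ℝ} {lam : ℝ} {V : Set (N → ℝ)} (hx : x ∈ V)
    (hV : ∀ T, x + lam • ind T ∈ V) {b : ℕ} {α : Type} {A : Alg (Finset N) α} :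
    ∀ {r : ℕ}, A.IsAdaptive Set.univ b r → (onStep x lam A).IsAdaptive V (b + 1) r := by
  induction A with
  | output a => intros; trivial
  | sample p next ih => exact fun h y hy => ih y (h y hy)
  | round qs next ih =>
    intro r h
    cases r with
    | zero => exact h.elim
    | succ r =>
      refine ⟨(Finset.card_insert_le _ _).trans
        (Nat.succ_le_succ (Finset.card_image_le.trans h.1)), fun q hq => ?_,
        fun ans => ih _ (h.2.2 _)⟩
      rcases Finset.mem_insert.1 hq with rfl | hq
      · exact hx
      · obtain ⟨T, -, rfl⟩ := Finset.mem_image.1 hq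
        exact hV T

/-! ### Random sequences -/

theorem mem_extensions {I : Finset N → Prop} {l : List N} {a : N} :
    a ∈ extensions I l ↔ a ∉ l ∧ I (insert a l.toFinset) := by
  simp [extensions]

theorem mem_support_extend {I : Finset N → Prop} {l l' : List N}
    (h : l' ∈ (extend I l).support) : l' = l ∨ ∃ a ∈ extensions I l, l' = l ++ [a] := by
  unfold extend at h
  split_ifs at h
  · rw [PMF.mem_support_map_iff] at h
    obtain ⟨a, ha, rfl⟩ := h
    exact Or.inr ⟨a, (PMF.mem_support_uniformOfFinset_iff _ a).1 ha, rfl⟩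
  · exact Or.inl ((PMF.mem_support_pure_iff _ _).1 h)

/-- A property of sequences that passes to all extensions holds for random sequences. -/
theorem randomPrefix_induction {I : Finset N → Prop} {P : List N → Prop} (h0 : P [])
    (h1 : ∀ l a, P l → a ∈ extensions I l → P (l ++ [a])) :
    ∀ i, ∀ l ∈ (randomPrefix I i).support, P l := by
  intro i
  induction i with
  | zero =>
    intro l hl
    rwa [(PMF.mem_support_pure_iff _ _).1 hl]
  | succ i ih =>
    intro l hl
    obtain ⟨l₀, h₀, hl⟩ := (PMF.mem_support_bind_iff _ _ _).1 hl
    rcases mem_support_extend hl with rfl | ⟨a, ha, rfl⟩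
    · exact ih _ h₀
    · exact h1 _ a (ih _ h₀) ha

theorem randomPrefix_nodup {I : Finset N → Prop} {i : ℕ} {l : List N}
    (hl : l ∈ (randomPrefix I i).support) : l.Nodup :=
  randomPrefix_induction (P := List.Nodup) List.nodup_nil
    (fun l a h ha => by
      rw [List.nodup_append]
      refine ⟨h, by simp, fun b hb c hc hbc => (mem_extensions.1 ha).1 ?_⟩
      rw [List.mem_singleton] at hc
      rwa [← hc, ← hbc]) i l hl

theorem randomPrefix_residual_subset {I : Finset N → Prop} {S X : Finset N} {i : ℕ} {l : List N}
    (hl : l ∈ (randomPrefix (residual I S X) i).support) : l.toFinset ⊆ X :=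
  randomPrefix_induction (P := fun l => l.toFinset ⊆ X) (by simp)
    (fun l a _ ha => by
      have := (mem_extensions.1 ha).2.1
      intro b hb
      apply this
      simpa [or_comm] using hb) i l hl

theorem upTo_append_of_le {S : Finset N} {l : List N} {a : N} {i : ℕ} (hi : i ≤ l.length) :
    upTo S (l ++ [a]) i = upTo S l i := by
  unfold upTo
  rw [List.take_append_of_le_length hi]

theorem upTo_append_length_succ {S : Finset N} {l : List N} {a : N} :
    upTo S (l ++ [a]) (l.length + 1) = insert a (upTo S l l.length) := by
  unfold upTo
  rw [List.take_of_length_le (by simp), List.take_length]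
  ext b
  simp

theorem subset_upTo (S : Finset N) (l : List N) (i : ℕ) : S ⊆ upTo S l i :=
  Finset.subset_union_left

/-! ### The number of rounds -/

theorem card_queries_le {S X : Finset N} {l : List N} (hl : l.Nodup) :
    (queries S X l).card ≤ (Fintype.card N + 1) ^ 2 := by
  have h1 : l.length ≤ Fintype.card N := by
    rw [← List.toFinset_card_of_nodup hl]
    exact Finset.card_le_univ _
  refine Finset.card_biUnion_le.trans ((Finset.sum_le_card_nsmul _ _ (Fintype.card N + 1)
    fun i _ => (Finset.card_insert_le _ _).trans
      (Nat.succ_le_succ (Finset.card_image_le.trans (Finset.card_le_univ X)))).trans ?_)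
  rw [Finset.card_range, smul_eq_mul, sq]
  exact Nat.mul_le_mul_right _ (by omega)

/-- A complete random sequence is maximal, so nothing is good at its end. Hence the `sInf` in
`cutoff` is over a nonempty set and is not the default `0`. -/
theorem card_good_cutoff_le {I : Finset N → Prop} {g : Finset N → ℝ} {ε t : ℝ}
    (hε' : ε ≤ 1) {S X : Finset N} {l : List N}
    (hl : l ∈ (randomSequence (residual I S X)).support) :
    cutoff I g ε t S X l ≤ l.length ∧
      ((good I g t X (upTo S l (cutoff I g ε t S X l))).card : ℝ) ≤ (1 - ε) * X.card := by
  have hne : {i : ℕ | i ≤ l.length ∧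
      ((good I g t X (upTo S l i)).card : ℝ) ≤ (1 - ε) * X.card}.Nonempty := by
    refine ⟨l.length, le_rfl, ?_⟩
    have : good I g t X (upTo S l l.length) = ∅ := by
      rw [Finset.eq_empty_iff_forall_notMem]
      intro a ha
      obtain ⟨haX, haA, haI, -⟩ := Finset.mem_filter.1 ha
      simp only [upTo, List.take_length] at haA haI
      have : a ∈ extensions (residual I S X) l := by
        refine mem_extensions.2 ⟨fun h => haA (Finset.mem_union_right _ (by simpa using h)),
          Finset.insert_subset haX (randomPrefix_residual_subset hl), ?_⟩
        rwa [Finset.union_insert]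
      simp [extensions_eq_empty hl] at this
    rw [this, Finset.card_empty, Nat.cast_zero]
    exact mul_nonneg (by linarith) (Nat.cast_nonneg _)
  exact Nat.sInf_mem hne

/-- The cutoff shrinks `|X|` by `1 - ε` for any answers whatsoever, and a cardinality below `1` is
`0`. So `p`, not the fuel, bounds the rounds. -/
theorem isAdaptive_whileLoop {I : Finset N → Prop} {ε : ℝ} (hε' : ε ≤ 1) (t : ℝ) :
    ∀ (fuel p : ℕ) (S X : Finset N), (1 - ε) ^ p * X.card < 1 →
      (whileLoop I ε t fuel S X).IsAdaptive Set.univ ((Fintype.card N + 1) ^ 2) p := by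
  intro fuel
  induction fuel with
  | zero => intros; trivial
  | succ fuel ih =>
    intro p S X hp
    unfold whileLoop
    split_ifs with hX
    · trivial
    · intro l hl
      cases p with
      | zero =>
        have : (1 : ℝ) ≤ X.card := by
          exact_mod_cast Finset.card_pos.2 (Finset.nonempty_iff_ne_empty.2 hX)
        linarith
      | succ p =>
        refine ⟨card_queries_le (randomPrefix_nodup hl), fun _ _ => Set.mem_univ _,
          fun g => ih p _ _ (lt_of_le_of_lt ?_ hp)⟩
        rw [pow_succ, mul_assoc]
        exact mul_le_mul_of_nonneg_left (card_good_cutoff_le hε' hl).2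
          (pow_nonneg (by linarith) _)

theorem isAdaptive_thresholdLoop {I : Finset N → Prop} {ε : ℝ} (hε' : ε ≤ 1) {p : ℕ}
    (hp : (1 - ε) ^ p * Fintype.card N < 1) :
    ∀ (j : ℕ) (t : ℝ) (S : Finset N),
      (thresholdLoop I ε j t S).IsAdaptive Set.univ ((Fintype.card N + 1) ^ 2) (j * p) := by
  intro j
  induction j with
  | zero => intros; trivial
  | succ j ih =>
    intro t S
    rw [Nat.succ_mul, Nat.add_comm (j * p)]
    exact Alg.IsAdaptive.bind (fun S' => ih _ S')
      (isAdaptive_whileLoop hε' t _ p S _ (by rwa [Finset.card_univ]))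

theorem isAdaptive_adaptiveSequencing {I : Finset N → Prop} {ε : ℝ} (hε' : ε ≤ 1)
    {p : ℕ} (hp : (1 - ε) ^ p * Fintype.card N < 1) (Δ : ℕ) :
    (adaptiveSequencing I ε Δ).IsAdaptive Set.univ ((Fintype.card N + 1) ^ 2) (Δ * p + 1) := by
  refine ⟨Finset.card_image_le.trans ?_, fun _ _ => Set.mem_univ _,
    fun g => isAdaptive_thresholdLoop hε' hp Δ _ _⟩
  rw [Finset.card_univ]
  nlinarith

theorem isAdaptive_greedyLoop {I : Finset N → Prop} {ε : ℝ} (hε' : ε ≤ 1) {p : ℕ}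
    (hp : (1 - ε) ^ p * Fintype.card N < 1) (Δ : ℕ) {lam : ℝ} (hlam : 0 ≤ lam) :
    ∀ (j : ℕ) (x : N → ℝ), (∀ i, 0 ≤ x i ∧ x i + j * lam ≤ 1) →
      (greedyLoop I ε Δ lam j x).IsAdaptive cube ((Fintype.card N + 1) ^ 2 + 1)
        (j * (Δ * p + 1)) := by
  intro j
  induction j with
  | zero => intros; trivial
  | succ j ih =>
    intro x hx
    have hx' : ∀ (T : Finset N) i, 0 ≤ (x + lam • ind T) i ∧ (x + lam • ind T) i + j * lam ≤ 1 := by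
      intro T i
      have h1 := ind_mem_cube T i
      have h2 := hx i
      push_cast at h2
      simp only [Pi.add_apply, Pi.smul_apply, smul_eq_mul]
      constructor <;> nlinarith
    have hj : 0 ≤ j * lam := by positivity
    rw [Nat.succ_mul, Nat.add_comm (j * _)]
    refine Alg.IsAdaptive.bind (fun S => ih _ (hx' S))
      (Alg.IsAdaptive.onStep (fun i => ⟨(hx i).1, ?_⟩) (fun T i => ⟨(hx' T i).1, ?_⟩)
        (isAdaptive_adaptiveSequencing hε' hp Δ))
    · have := (hx i).2
      push_cast at this
      linarith
    · linarith [(hx' T i).2]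

theorem isAdaptive_acceleratedContinuousGreedy (M : Matroid N) {ε : ℝ} (hε' : ε ≤ 1)
    {p : ℕ} (hp : (1 - ε) ^ p * Fintype.card N < 1) {m : ℕ} (hm : 1 ≤ m) :
    (acceleratedContinuousGreedy M ε m).IsAdaptive cube ((Fintype.card N + 1) ^ 2 + 1)
      (m * (numThresholds (rank (feasible M)) ε (1 / m) * p + 1)) := by
  refine isAdaptive_greedyLoop hε' hp _ (by positivity) m 0 fun i => ?_
  have : (m : ℝ) ≠ 0 := by positivity
  simp [this]

/-- `log n / ε` passes exhaust a set of `n` elements that shrinks by the factor `1 - ε`. -/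
theorem one_sub_pow_mul_lt_one {ε : ℝ} (hε' : ε ≤ 1) {n p : ℕ} (hn : 1 ≤ n)
    (hp : Real.log n < ε * p) : (1 - ε) ^ p * (n : ℝ) < 1 := by
  have hn' : (0 : ℝ) < n := by exact_mod_cast hn
  have h1 : (1 - ε) ^ p ≤ Real.exp (-(ε * p)) := by
    have : Real.exp (-(ε * p)) = Real.exp (-ε) ^ p := by
      rw [← Real.exp_nat_mul]
      congr 1
      ring
    rw [this]
    exact pow_le_pow_left₀ (by linarith) (Real.one_sub_le_exp_neg ε) p
  calc (1 - ε) ^ p * (n : ℝ) ≤ Real.exp (-(ε * p)) * Real.exp (Real.log n) := by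
        rw [Real.exp_log hn']
        gcongr
    _ = Real.exp (Real.log n - ε * p) := by
        rw [← Real.exp_add]
        congr 1
        ring
    _ < 1 := Real.exp_lt_one_iff.2 (by linarith)

theorem log_two_le_log_div {k : ℕ} {ε lam : ℝ} (hε : 0 < ε) (hlam : 0 < lam) (hk : 1 ≤ k)
    (h : ε * lam ≤ 1 / 2) : Real.log 2 ≤ Real.log (k / (ε * lam)) := by
  have hk' : (1 : ℝ) ≤ k := by exact_mod_cast hk
  refine Real.log_le_log two_pos ?_
  rw [le_div_iff₀ (mul_pos hε hlam)]
  linarith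

theorem exists_isAdaptive_acceleratedContinuousGreedy {n : ℕ} (hn : 2 ≤ n) (M : Matroid (Fin n))
    {k : ℕ} (hk : k = rank (feasible M)) (hk1 : 1 ≤ k) {ε : ℝ} (hε : 0 < ε) (hε' : ε ≤ 1) {m : ℕ}
    (hm : 1 ≤ m) (h : ε * (1 / m) ≤ 1 / 2) :
    ∃ r : ℕ, (r : ℝ) ≤
        13 * (Real.log n * Real.log (k / (ε * (1 / m))) / (ε ^ 2 * (1 / m))) ∧
      (acceleratedContinuousGreedy M ε m).IsAdaptive cube ((n + 1) ^ 2 + 1) r := by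
  have hm' : (0 : ℝ) < m := by exact_mod_cast hm
  have hL := log_two_le_log_div hε (one_div_pos.2 hm') hk1 h
  have hl : Real.log 2 ≤ Real.log n := Real.log_le_log two_pos (by exact_mod_cast hn)
  have h2 := Real.log_two_gt_d9
  set L := Real.log (k / (ε * (1 / m)))
  set l := Real.log n
  have hl0 : 0 ≤ l := by linarith
  -- Absorbs rounding up to integers: both logarithms are at least `log 2 > 1 / 2`.
  have ceil_le : ∀ y : ℝ, 1 / 2 ≤ y → y / ε + 1 ≤ 3 * (y / ε) := by
    intro y hy
    have : 1 / 2 ≤ y / ε := hy.trans (le_div_self (by linarith) hε hε')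
    linarith
  have hp0 : ((⌊l / ε⌋₊ + 1 : ℕ) : ℝ) ≤ 3 * (l / ε) := by
    refine le_trans ?_ (ceil_le l (by linarith))
    push_cast
    have := Nat.floor_le (div_nonneg hl0 hε.le)
    linarith
  have hΔ : (numThresholds (rank (feasible M)) ε (1 / m) : ℝ) ≤ 3 * (L / ε) := by
    rw [← hk]
    exact (Nat.ceil_lt_add_one (div_nonneg (by linarith) hε.le)).le.trans (ceil_le L (by linarith))
  have hp : (1 - ε) ^ (⌊l / ε⌋₊ + 1) * (Fintype.card (Fin n) : ℝ) < 1 := by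
    rw [Fintype.card_fin]
    refine one_sub_pow_mul_lt_one hε' (by omega) ?_
    have := Nat.lt_floor_add_one (l / ε)
    rw [div_lt_iff₀ hε] at this
    push_cast
    linarith
  have hr := isAdaptive_acceleratedContinuousGreedy M hε' hp hm
  rw [Fintype.card_fin] at hr
  refine ⟨_, ?_, hr⟩
  -- Pays for the extra round that fetches the singletons. Altogether `3 * 3 + 4 = 13`.
  have h1 : 1 ≤ 4 * ((L / ε) * (l / ε)) := by
    have h3 : 1 / 2 ≤ L / ε := le_trans (by linarith) (le_div_self (by linarith) hε hε')
    have h4 : 1 / 2 ≤ l / ε := le_trans (by linarith) (le_div_self (by linarith) hε hε')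
    nlinarith
  have h5 := mul_le_mul hΔ hp0 (Nat.cast_nonneg _) ((Nat.cast_nonneg _).trans hΔ)
  calc ((m * (numThresholds (rank (feasible M)) ε (1 / m) * (⌊l / ε⌋₊ + 1) + 1) : ℕ) : ℝ)
      = m * ((numThresholds (rank (feasible M)) ε (1 / m) : ℝ) * ((⌊l / ε⌋₊ + 1 : ℕ) : ℝ) + 1) := by
        push_cast
        ring
    _ ≤ m * (3 * (L / ε) * (3 * (l / ε)) + 4 * ((L / ε) * (l / ε))) := by gcongr
    _ = _ := by
        field_simp
        ring

/-! ### Greedy sequences in a matroid -/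

/-- No feasible extension of `S` has marginal contribution larger than `T`. -/
def MarginalsLE (M : Matroid N) (g : Finset N → ℝ) (S : Finset N) (T : ℝ) : Prop :=
  ∀ b ∉ S, feasible M (insert b S) → g (insert b S) - g S ≤ T

theorem feasible.subset {M : Matroid N} {S T : Finset N} (hT : feasible M T) (h : S ⊆ T) :
    feasible M S :=
  Matroid.Indep.subset hT (by exact_mod_cast h)

theorem MarginalsLE.anti {M : Matroid N} {g : Finset N → ℝ} (hg : IsSubmodular g)
    {S S' : Finset N} {T : ℝ} (h : MarginalsLE M g S T) (hS : S ⊆ S') : MarginalsLE M g S' T :=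
  fun b hb hf => (hg S S' hS b hb).trans
    (h b (fun hbS => hb (hS hbS)) (hf.subset (Finset.insert_subset_insert b hS)))

/-- The feasible set `S` can be built by adding elements one by one in such a way that `s` is the
sum of upper bounds for the marginal contributions that were possible at each step. -/
inductive Reached (M : Matroid N) (g : Finset N → ℝ) : Finset N → ℝ → Prop
  | empty : Reached M g ∅ 0
  | insert {S : Finset N} {s : ℝ} (h : Reached M g S s) {a : N} (ha : a ∉ S)
      (hf : feasible M (insert a S)) {T : ℝ} (hT : 0 ≤ T) (hM : MarginalsLE M g S T) :
      Reached M g (insert a S) (s + T)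

theorem Reached.feasible {M : Matroid N} {g : Finset N → ℝ} {S : Finset N} {s : ℝ}
    (h : Reached M g S s) : feasible M S := by
  cases h with
  | empty =>
    unfold Adaptive.feasible
    simp
  | insert _ _ hf => exact hf

theorem exists_feasible_insert {M : Matroid N} {S O : Finset N} (hS : feasible M S)
    (hO : feasible M O) (h : S.card < O.card) : ∃ o ∈ O, o ∉ S ∧ feasible M (insert o S) := by
  obtain ⟨o, ho, hoS, hi⟩ := Matroid.Indep.augment_finset hS hO h
  exact ⟨o, ho, hoS, by simpa [feasible] using hi⟩

/-- The last step of the construction is peeled off. If `O` is larger than the previous set,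
augmentation yields an `o` in `O` that could have been added then, so `d o` is at most the bound `T`
of that step, and `O.erase o` is left to the earlier steps. -/
theorem Reached.sum_le {M : Matroid N} {g : Finset N → ℝ} {S : Finset N} {s : ℝ}
    (h : Reached M g S s) {d : N → ℝ} :
    (∀ A ⊆ S, ∀ o ∉ A, d o ≤ g (Insert.insert o A) - g A) →
    ∀ O : Finset N, Adaptive.feasible M O → O.card ≤ S.card → ∑ o ∈ O, d o ≤ s := by
  induction h with
  | empty =>
    intro _ O _ hO
    rw [Finset.card_eq_zero.1 (Nat.le_zero.1 hO), Finset.sum_empty]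
  | @insert S s h a ha hf T hT hM ih =>
    intro hd O hO hc
    have ih' := ih fun A hA => hd A (hA.trans (Finset.subset_insert a S))
    rw [Finset.card_insert_of_notMem ha] at hc
    by_cases hle : O.card ≤ S.card
    · linarith [ih' O hO hle]
    · obtain ⟨o, hoO, hoS, ho⟩ := exists_feasible_insert h.feasible hO (not_le.1 hle)
      have h1 := hd S (Finset.subset_insert a S) o hoS
      have h2 := hM o hoS ho
      have h3 := ih' (O.erase o) (hO.subset (Finset.erase_subset _ _))
        (by rw [Finset.card_erase_of_mem hoO]; omega)
      rw [← Finset.add_sum_erase O d hoO]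
      linarith

/-- Elements of `O` in excess of `|S|` can be chosen to extend the final set, so each costs at most
the final bound `T`. -/
theorem Reached.sum_le_add {M : Matroid N} {g : Finset N → ℝ} {S : Finset N} {s T : ℝ}
    (h : Reached M g S s) (hT : 0 ≤ T) (hM : MarginalsLE M g S T) {d : N → ℝ}
    (hd : ∀ A ⊆ S, ∀ o ∉ A, d o ≤ g (Insert.insert o A) - g A) {O : Finset N}
    (hO : Adaptive.feasible M O) : ∑ o ∈ O, d o ≤ s + O.card * T := by
  have key : ∀ (n : ℕ) (O : Finset N), Adaptive.feasible M O → O.card ≤ S.card + n →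
      ∑ o ∈ O, d o ≤ s + n * T := by
    intro n
    induction n with
    | zero =>
      intro O hO hc
      simpa using h.sum_le hd O hO hc
    | succ n ih =>
      intro O hO hc
      push_cast
      by_cases hle : O.card ≤ S.card
      · have := h.sum_le hd O hO hle
        have : 0 ≤ (n + 1) * T := by positivity
        linarith
      · obtain ⟨o, hoO, hoS, ho⟩ := exists_feasible_insert h.feasible hO (not_le.1 hle)
        have h1 := hd S subset_rfl o hoS
        have h2 := hM o hoS ho
        have h3 := ih (O.erase o) (hO.subset (Finset.erase_subset _ _))
          (by rw [Finset.card_erase_of_mem hoO]; omega)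
        rw [← Finset.add_sum_erase O d hoO]
        linarith
  exact key _ O hO (Nat.le_add_left _ _)

/-! ### Queries determine the passes -/

theorem good_congr {I : Finset N → Prop} {g g' : Finset N → ℝ} {t : ℝ} {X A : Finset N}
    (hA : g A = g' A) (h : ∀ a ∈ X, g (insert a A) = g' (insert a A)) :
    good I g t X A = good I g' t X A :=
  Finset.filter_congr fun a ha => by rw [hA, h a ha]

theorem good_congr_of_queries {I : Finset N → Prop} {g g' : Finset N → ℝ} {t : ℝ}
    {S X : Finset N} {l : List N} (h : ∀ q ∈ queries S X l, g q = g' q) {i : ℕ}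
    (hi : i ≤ l.length) : good I g t X (upTo S l i) = good I g' t X (upTo S l i) := by
  have h' : ∀ q ∈ insert (upTo S l i) (X.image fun a => insert a (upTo S l i)), g q = g' q :=
    fun q hq => h q (Finset.mem_biUnion.2 ⟨i, Finset.mem_range.2 (by omega), hq⟩)
  exact good_congr (h' _ (Finset.mem_insert_self _ _)) fun a ha =>
    h' _ (Finset.mem_insert_of_mem (Finset.mem_image_of_mem _ ha))

theorem cutoff_congr_of_queries {I : Finset N → Prop} {g g' : Finset N → ℝ} {ε t : ℝ}
    {S X : Finset N} {l : List N} (h : ∀ q ∈ queries S X l, g q = g' q) :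
    cutoff I g ε t S X l = cutoff I g' ε t S X l := by
  unfold cutoff
  congr 1
  ext i
  simp only [Set.mem_ofPred_eq]
  exact and_congr_right fun hi => by rw [good_congr_of_queries h hi]

/-- The answers agree with `g` only on the batch and are `0` elsewhere. The batch already determines
the cutoff and the good set, so they may be replaced by `g`. -/
theorem mean_whileLoop_succ {I : Finset N → Prop} {ε t : ℝ} (hε' : ε ≤ 1)
    (g : Finset N → ℝ) (fuel : ℕ) {S X : Finset N} (hX : X ≠ ∅) (φ : Finset N → ℝ≥0∞) :
    mean ((whileLoop I ε t (fuel + 1) S X).run g) φ ≤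
      mean (randomSequence (residual I S X)) fun l =>
        mean ((whileLoop I ε t fuel (upTo S l (cutoff I g ε t S X l))
          (good I g t X (upTo S l (cutoff I g ε t S X l)))).run g) φ := by
  conv_lhs => unfold whileLoop
  rw [if_neg hX]
  simp only [Alg.run, mean_bind]
  have key : ∀ l ∈ (randomSequence (residual I S X)).support, ∀ g' : Finset N → ℝ,
      (∀ q ∈ queries S X l, g' q = g q) →
      whileLoop I ε t fuel (upTo S l (cutoff I g' ε t S X l))
          (good I g' t X (upTo S l (cutoff I g' ε t S X l))) =
        whileLoop I ε t fuel (upTo S l (cutoff I g ε t S X l))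
          (good I g t X (upTo S l (cutoff I g ε t S X l))) := fun l hl g' h => by
    rw [cutoff_congr_of_queries h, good_congr_of_queries h (card_good_cutoff_le hε' hl).1]
  refine mean_mono fun l hl => le_of_eq ?_
  exact congrArg (fun A => mean (Alg.run g A) φ) (key l hl _ fun q hq => if_pos hq)

/-! ### Stopping a random sequence at the cutoff -/

/-- The set `S` together with the sequence up to the cutoff, or with the whole sequence if it has
not yet reached the cutoff. -/
def stopped (I : Finset N → Prop) (g : Finset N → ℝ) (ε t : ℝ) (S X : Finset N) (l : List N) :
    Finset N :=
  if ∃ i ≤ l.length, ((good I g t X (upTo S l i)).card : ℝ) ≤ (1 - ε) * X.card then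
    upTo S l (cutoff I g ε t S X l)
  else upTo S l l.length

theorem stopped_nil {I : Finset N → Prop} {g : Finset N → ℝ} {ε t : ℝ} {S X : Finset N} :
    stopped I g ε t S X [] = S := by
  unfold stopped
  split_ifs <;> simp [upTo]

theorem stopped_append_of_exists {I : Finset N → Prop} {g : Finset N → ℝ} {ε t : ℝ}
    {S X : Finset N} {l : List N}
    (h : ∃ i ≤ l.length, ((good I g t X (upTo S l i)).card : ℝ) ≤ (1 - ε) * X.card) (a : N) :
    stopped I g ε t S X (l ++ [a]) = stopped I g ε t S X l := by
  have hlen : (l ++ [a]).length = l.length + 1 := by simp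
  have h' : ∃ i ≤ (l ++ [a]).length,
      ((good I g t X (upTo S (l ++ [a]) i)).card : ℝ) ≤ (1 - ε) * X.card := by
    obtain ⟨i, hi, h⟩ := h
    exact ⟨i, by omega, by rwa [upTo_append_of_le hi]⟩
  obtain ⟨h1, h2⟩ : cutoff I g ε t S X l ≤ l.length ∧ ((good I g t X (upTo S l
      (cutoff I g ε t S X l))).card : ℝ) ≤ (1 - ε) * X.card := Nat.sInf_mem h
  have hc : cutoff I g ε t S X (l ++ [a]) = cutoff I g ε t S X l := by
    refine le_antisymm (Nat.sInf_le ⟨by omega, by rwa [upTo_append_of_le h1]⟩) ?_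
    obtain ⟨h3, h4⟩ : cutoff I g ε t S X (l ++ [a]) ≤ (l ++ [a]).length ∧
      ((good I g t X (upTo S (l ++ [a]) (cutoff I g ε t S X (l ++ [a])))).card : ℝ) ≤
        (1 - ε) * X.card := Nat.sInf_mem h'
    by_contra hlt
    have h5 : cutoff I g ε t S X (l ++ [a]) ≤ l.length := by omega
    rw [upTo_append_of_le h5] at h4
    exact hlt (Nat.sInf_le ⟨h5, h4⟩)
  rw [stopped, if_pos h', stopped, if_pos h, hc, upTo_append_of_le h1]

theorem stopped_append_of_not_exists {I : Finset N → Prop} {g : Finset N → ℝ} {ε t : ℝ}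
    {S X : Finset N} {l : List N}
    (h : ¬ ∃ i ≤ l.length, ((good I g t X (upTo S l i)).card : ℝ) ≤ (1 - ε) * X.card) (a : N) :
    stopped I g ε t S X (l ++ [a]) = insert a (upTo S l l.length) := by
  have hlen : (l ++ [a]).length = l.length + 1 := by simp
  rw [← upTo_append_length_succ]
  unfold stopped
  split_ifs with h'
  · have h1 : cutoff I g ε t S X (l ++ [a]) ≤ (l ++ [a]).length ∧
      ((good I g t X (upTo S (l ++ [a]) (cutoff I g ε t S X (l ++ [a])))).card : ℝ) ≤
        (1 - ε) * X.card := Nat.sInf_mem h'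
    have h2 : ¬ cutoff I g ε t S X (l ++ [a]) ≤ l.length := fun hle => by
      rw [upTo_append_of_le hle] at h1
      exact h ⟨_, hle, h1.2⟩
    congr 1
    omega
  · rw [hlen]

/-- Optional stopping: a potential that decreases in expectation until the cutoff. -/
theorem mean_stopped_le {I : Finset N → Prop} {g : Finset N → ℝ} {ε t : ℝ} {S X : Finset N}
    {φ : Finset N → ℝ≥0∞} (n : ℕ)
    (hφ : ∀ i, ∀ l ∈ (randomPrefix (residual I S X) i).support,
      (1 - ε) * X.card < (good I g t X (upTo S l l.length)).card →
      ∀ h : (extensions (residual I S X) l).Nonempty,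
        mean (PMF.uniformOfFinset _ h) (fun a => φ (insert a (upTo S l l.length))) ≤
          φ (upTo S l l.length)) :
    mean (randomPrefix (residual I S X) n) (fun l => φ (stopped I g ε t S X l)) ≤ φ S := by
  induction n with
  | zero => rw [randomPrefix, mean_pure, stopped_nil]
  | succ n ih =>
    rw [randomPrefix, mean_bind]
    refine (mean_mono fun l hl => ?_).trans ih
    unfold extend
    split_ifs with hne
    · rw [mean_map]
      by_cases h : ∃ i ≤ l.length, ((good I g t X (upTo S l i)).card : ℝ) ≤ (1 - ε) * X.card
      · simp only [stopped_append_of_exists h, mean_const, le_refl]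
      · simp only [stopped_append_of_not_exists h]
        rw [stopped, if_neg h]
        refine hφ n l hl ?_ hne
        by_contra hc
        exact h ⟨_, le_rfl, not_lt.1 hc⟩
    · rw [mean_pure]

/-! ### The potential -/

/-- The one-step supermartingale inequality, with `v = θ t`: every addition is charged `(1 - 2ε) v`,
and a good one gains `v`. Up to the factor `exp (-2εv)` the left side is `1 - ε + ε exp v ≤ 1 + 2εv
≤ exp (2εv)`. -/
theorem exp_mul_le_one {ε v : ℝ} (hε : 0 ≤ ε) (hv : 0 ≤ v) (hv' : v ≤ 1) :
    (1 - ε) * Real.exp ((1 - 2 * ε) * v - v) + ε * Real.exp ((1 - 2 * ε) * v) ≤ 1 := by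
  have h1 : Real.exp v ≤ 1 + 2 * v := by
    have := (abs_le.1 (Real.abs_exp_sub_one_sub_id_le (x := v) (by rwa [abs_of_nonneg hv]))).2
    nlinarith
  have h2 : 1 + 2 * ε * v ≤ Real.exp (2 * ε * v) := by
    linarith [Real.add_one_le_exp (2 * ε * v)]
  have h3 : Real.exp ((1 - 2 * ε) * v) = Real.exp ((1 - 2 * ε) * v - v) * Real.exp v := by
    rw [← Real.exp_add]
    ring_nf
  have h4 : Real.exp ((1 - 2 * ε) * v - v) * Real.exp (2 * ε * v) = 1 := by
    rw [← Real.exp_add, Real.exp_eq_one_iff]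
    ring
  rw [h3]
  have h5 := Real.exp_pos ((1 - 2 * ε) * v - v)
  have h6 : (1 - ε) + ε * Real.exp v ≤ Real.exp (2 * ε * v) := by nlinarith
  nlinarith

theorem sum_le_card_mul {α : Type*} {ε v c : ℝ} (hε : 0 ≤ ε) (hv : 0 ≤ v)
    (hv' : v ≤ 1) (hc : 0 ≤ c) {E G : Finset α} (hGE : G ⊆ E)
    (hG : (1 - ε) * E.card ≤ G.card) {h : α → ℝ}
    (h1 : ∀ a ∈ G, h a ≤ c * Real.exp ((1 - 2 * ε) * v - v))
    (h2 : ∀ a ∈ E, h a ≤ c * Real.exp ((1 - 2 * ε) * v)) :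
    ∑ a ∈ E, h a ≤ E.card * c := by
  have key := exp_mul_le_one hε hv hv'
  set e₁ := Real.exp ((1 - 2 * ε) * v - v)
  set e₂ := Real.exp ((1 - 2 * ε) * v)
  have he : e₁ ≤ e₂ := Real.exp_le_exp.2 (by linarith)
  have hs1 : ∑ a ∈ G, h a ≤ G.card * (c * e₁) := by
    simpa using Finset.sum_le_card_nsmul G h _ h1
  have hs2 : ∑ a ∈ E \ G, h a ≤ (E.card - G.card) * (c * e₂) := by
    have := Finset.sum_le_card_nsmul (E \ G) h _ fun a ha => h2 a (Finset.mem_sdiff.1 ha).1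
    rwa [nsmul_eq_mul, Finset.cast_card_sdiff hGE] at this
  rw [← Finset.sum_sdiff hGE]
  have h3 : 0 ≤ (G.card - (1 - ε) * E.card) * (c * (e₂ - e₁)) :=
    mul_nonneg (by linarith) (mul_nonneg hc (by linarith))
  have h4 : 0 ≤ E.card * c * (1 - ((1 - ε) * e₁ + ε * e₂)) :=
    mul_nonneg (mul_nonneg (Nat.cast_nonneg _) hc) (by linarith)
  linarith

/-- The exponential potential of a set `S` with bound `s` as in `Reached`. -/
def potential (g : Finset N → ℝ) (ε θ : ℝ) (S : Finset N) (s : ℝ) : ℝ :=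
  Real.exp (θ * ((1 - ε) * (1 - 2 * ε) * s - g S))

section analysis

variable {M : Matroid N} {g : Finset N → ℝ} {ε θ t : ℝ}

/-- By submodularity the bound `T` at `S` serves for the whole sequence. Only `|upTo S l j| - |S|`
additions are counted, because the sequence may contain elements of `S`. -/
theorem reached_upTo (hg : IsSubmodular g) {S X : Finset N} {s T : ℝ} (hT : 0 ≤ T)
    (hR : Reached M g S s) (hM : MarginalsLE M g S T) :
    ∀ i, ∀ l ∈ (randomPrefix (residual (feasible M) S X) i).support, ∀ j ≤ l.length,
      Reached M g (upTo S l j) (s + ((upTo S l j).card - S.card) * T) := by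
  refine randomPrefix_induction ?_ ?_
  · intro j _
    simpa [upTo] using hR
  · intro l a ih ha j hj
    rw [List.length_append, List.length_singleton] at hj
    rcases Nat.lt_or_ge l.length j with h | h
    · obtain rfl : j = l.length + 1 := by omega
      rw [upTo_append_length_succ]
      have h1 := ih _ le_rfl
      by_cases haA : a ∈ upTo S l l.length
      · rwa [Finset.insert_eq_of_mem haA]
      · have hf : feasible M (insert a (upTo S l l.length)) := by
          have := (mem_extensions.1 ha).2.2
          rw [Finset.union_insert] at this
          simpa [upTo] using this
        have h2 := h1.insert haA hf hT (hM.anti hg (subset_upTo S l _))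
        rw [Finset.card_insert_of_notMem haA]
        convert h2 using 1
        push_cast
        ring
    · rw [upTo_append_of_le h]
      exact ih j h

/-- An arbitrary terminal value `Ψ` lets the loops be composed. Two bounds on marginals are carried:
`t / (1 - ε)`, inherited from the previous threshold, prices every addition; `t` holds outside `X`
and becomes global once `X` is exhausted. The condition `hθε` allows both `ε ≤ 1 / 2` and `θ = 0`.
-/
theorem mean_whileLoop_le (hmono : Monotone g) (hg : IsSubmodular g) (hε : 0 < ε)
    (hε' : ε < 1) (hθ : 0 ≤ θ) (hθε : 0 ≤ (1 - 2 * ε) * θ) (ht : 0 ≤ t) (hθt : θ * t ≤ 1) {Ψ : Finset N → ℝ≥0∞}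
    (hΨ : ∀ S s, Reached M g S s → MarginalsLE M g S t →
      Ψ S ≤ ENNReal.ofReal (potential g ε θ S s)) :
    ∀ (fuel : ℕ) (S X : Finset N) (s : ℝ), X.card ≤ fuel → Reached M g S s →
      MarginalsLE M g S (t / (1 - ε)) →
      (∀ b ∉ X, b ∉ S → feasible M (insert b S) → g (insert b S) - g S ≤ t) →
      mean ((whileLoop (feasible M) ε t fuel S X).run g) Ψ ≤
        ENNReal.ofReal (potential g ε θ S s) := by
  have h1ε : 0 < 1 - ε := by linarith
  have hT : 0 ≤ t / (1 - ε) := by positivity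
  intro fuel
  induction fuel with
  | zero =>
    intro S X s hc hR _ hX
    rw [Finset.card_eq_zero.1 (Nat.le_zero.1 hc)] at hX
    rw [whileLoop, Alg.run, mean_pure]
    exact hΨ S s hR fun b => hX b (Finset.notMem_empty b)
  | succ fuel ih =>
    intro S X s hc hR hM hX
    by_cases hX0 : X = ∅
    · rw [whileLoop, if_pos hX0, Alg.run, mean_pure]
      subst hX0
      exact hΨ S s hR fun b => hX b (Finset.notMem_empty b)
    refine (mean_whileLoop_succ (by linarith) g fuel hX0 Ψ).trans ?_
    set h : Finset N → ℝ := fun A =>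
      potential g ε θ A (s + (A.card - S.card) * (t / (1 - ε))) with hh
    have hmean := mean_stopped_le (I := feasible M) (g := g) (ε := ε) (t := t) (S := S) (X := X)
      (φ := fun A => ENNReal.ofReal (h A)) (rank (residual (feasible M) S X)) ?_
    · have hS : h S = potential g ε θ S s := by simp [hh]
      rw [← hS]
      refine (mean_mono fun l hl => ?_).trans hmean
      obtain ⟨hcl, hcard⟩ := card_good_cutoff_le (g := g) (t := t) (by linarith : ε ≤ 1) hl
      have hlt := card_good_cutoff_lt (g := g) (t := t) hε (by linarith) hX0 hl
      rw [stopped, if_pos ⟨_, hcl, hcard⟩]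
      set A := upTo S l (cutoff (feasible M) g ε t S X l)
      have hSA : S ⊆ A := subset_upTo S l _
      refine ih A _ _ (by omega) (reached_upTo hg hT hR hM _ l hl _ hcl) (hM.anti hg hSA) ?_
      intro b hb hbA hf
      by_cases hbX : b ∈ X
      · by_contra hlt
        exact hb (Finset.mem_filter.2 ⟨hbX, hbA, hf, (not_le.1 hlt).le⟩)
      · exact (hg S A hSA b hbA).trans (hX b hbX (fun h => hbA (hSA h))
          (hf.subset (Finset.insert_subset_insert b hSA)))
    · intro i l hl hgood hne
      set A := upTo S l l.length with hA
      have hlX := randomPrefix_residual_subset hl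
      have hv : θ * (1 - ε) * (t / (1 - ε)) = θ * t := by field_simp
      refine mean_uniformOfFinset_le hne (fun a _ => (Real.exp_pos _).le) ?_
      have hEX : extensions (residual (feasible M) S X) l ⊆ X := fun a ha =>
        (mem_extensions.1 ha).2.1 (Finset.mem_insert_self _ _)
      refine sum_le_card_mul hε.le (mul_nonneg hθ ht) hθt (Real.exp_pos _).le
        (G := good (feasible M) g t X A) (fun a ha => ?_) ?_ (fun a ha => ?_) fun a ha => ?_
      · obtain ⟨haX, haA, hf, -⟩ := Finset.mem_filter.1 ha
        refine mem_extensions.2 ⟨fun h => haA ?_, Finset.insert_subset haX hlX, ?_⟩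
        · simp [hA, upTo, h]
        · rw [Finset.union_insert]
          simpa [hA, upTo] using hf
      · refine le_trans ?_ hgood.le
        gcongr
      · obtain ⟨-, haA, -, hta⟩ := Finset.mem_filter.1 ha
        simp only [hh, potential]
        rw [← Real.exp_add, Finset.card_insert_of_notMem haA]
        refine Real.exp_le_exp.2 ?_
        push_cast
        have := mul_le_mul_of_nonneg_left hta hθ
        linear_combination this + (1 - 2 * ε) * hv
      · simp only [hh, potential]
        rw [← Real.exp_add]
        refine Real.exp_le_exp.2 ?_
        -- An element already in `A` leaves the potential unchanged. It is not good, and is covered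
        -- by the weaker bound.
        by_cases haA : a ∈ A
        · rw [Finset.insert_eq_of_mem haA]
          have := mul_nonneg hθε ht
          linarith
        · rw [Finset.card_insert_of_notMem haA]
          push_cast
          have := mul_le_mul_of_nonneg_left (hmono (Finset.subset_insert a A)) hθ
          linear_combination this + (1 - 2 * ε) * hv

theorem mean_thresholdLoop_le (hmono : Monotone g) (hg : IsSubmodular g) (hε : 0 < ε)
    (hε' : ε < 1) (hθ : 0 ≤ θ) (hθε : 0 ≤ (1 - 2 * ε) * θ) {Ψ : Finset N → ℝ≥0∞} :
    ∀ (j : ℕ) (t : ℝ), 0 ≤ t → θ * t ≤ 1 →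
      (∀ S s, Reached M g S s → MarginalsLE M g S ((1 - ε) ^ j * t / (1 - ε)) →
        Ψ S ≤ ENNReal.ofReal (potential g ε θ S s)) →
      ∀ (S : Finset N) (s : ℝ), Reached M g S s → MarginalsLE M g S (t / (1 - ε)) →
        mean ((thresholdLoop (feasible M) ε j t S).run g) Ψ ≤
          ENNReal.ofReal (potential g ε θ S s) := by
  intro j
  induction j with
  | zero =>
    intro t _ _ hΨ S s hR hM
    rw [thresholdLoop, Alg.run, mean_pure]
    exact hΨ S s hR (by simpa using hM)
  | succ j ih =>
    intro t ht hθt hΨ S s hR hM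
    have h1ε : 0 < 1 - ε := by linarith
    rw [thresholdLoop, Alg.run_bind, mean_bind]
    refine mean_whileLoop_le hmono hg hε hε' hθ hθε ht hθt (fun S' s' hR' hM' => ?_) _ S _ s
      (Finset.card_univ (α := N)).le hR hM fun b hb => absurd (Finset.mem_univ b) hb
    refine ih ((1 - ε) * t) (by positivity) ?_ (fun S'' s'' hR'' hM'' => hΨ S'' s'' hR'' ?_) S' s'
      hR' ?_
    · refine le_trans (mul_le_mul_of_nonneg_left ?_ hθ) hθt
      nlinarith
    · rwa [pow_succ, mul_assoc]
    · rwa [mul_div_cancel_left₀ _ h1ε.ne']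

theorem le_maxSingleton {I : Finset N → Prop} {g : Finset N → ℝ} {a : N} (ha : I {a}) :
    g {a} ≤ maxSingleton I g := by
  have h : a ∈ Finset.univ.filter fun a : N => I {a} := by simpa using ha
  rw [maxSingleton, dif_pos ⟨a, h⟩]
  exact Finset.le_sup' (fun a => g {a}) h

theorem maxSingleton_mem {I : Finset N → Prop} {g : Finset N → ℝ} :
    maxSingleton I g = 0 ∨ ∃ a, I {a} ∧ maxSingleton I g = g {a} := by
  unfold maxSingleton
  split_ifs with h
  · obtain ⟨a, ha, h⟩ := Finset.exists_mem_eq_sup' h fun a => g {a}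
    exact Or.inr ⟨a, (Finset.mem_filter.1 ha).2, h⟩
  · exact Or.inl rfl

theorem maxSingleton_congr {I : Finset N → Prop} {g g' : Finset N → ℝ}
    (h : ∀ a, g {a} = g' {a}) : maxSingleton I g = maxSingleton I g' := by
  simp only [maxSingleton, h]

theorem mean_adaptiveSequencing_le (hmono : Monotone g) (hg : IsSubmodular g) (hg0 : g ∅ = 0)
    (hε : 0 < ε) (hε' : ε < 1) (hθ : 0 ≤ θ)
    (hθε : 0 ≤ (1 - 2 * ε) * θ) (hθt : θ * maxSingleton (feasible M) g ≤ 1)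
    (Δ : ℕ) {Ψ : Finset N → ℝ≥0∞}
    (hΨ : ∀ S s, Reached M g S s →
      MarginalsLE M g S ((1 - ε) ^ Δ * maxSingleton (feasible M) g / (1 - ε)) →
      Ψ S ≤ ENNReal.ofReal (potential g ε θ S s)) :
    mean ((adaptiveSequencing (feasible M) ε Δ).run g) Ψ ≤ 1 := by
  have ht : 0 ≤ maxSingleton (feasible M) g := by
    rcases maxSingleton_mem (I := feasible M) (g := g) with h | ⟨a, -, h⟩
    · exact h.ge
    · rw [h, ← hg0]
      exact hmono (Finset.empty_subset _)
  rw [adaptiveSequencing, Alg.run,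
    maxSingleton_congr (g' := g) fun a => if_pos (Finset.mem_image_of_mem _ (Finset.mem_univ a))]
  refine (mean_thresholdLoop_le hmono hg hε hε' hθ hθε Δ _ ht hθt hΨ ∅ 0 Reached.empty ?_).trans ?_
  · intro b _ hf
    rw [insert_empty_eq] at hf ⊢
    rw [hg0, sub_zero]
    refine (le_maxSingleton hf).trans (le_div_self ht (by linarith) (by linarith))
  · simp [potential, hg0]

end analysis

/-! ### One step of continuous greedy -/

section step

variable {f : Finset N → ℝ} {x : N → ℝ} {lam : ℝ}

theorem add_smul_ind_mem_cube_of_le (hlam : 0 ≤ lam) (hx : ∀ i, 0 ≤ x i ∧ x i + lam ≤ 1)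
    (T : Finset N) : x + lam • ind T ∈ cube := by
  intro i
  have := hx i
  have := ind_mem_cube T i
  simp only [Pi.add_apply, Pi.smul_apply, smul_eq_mul]
  constructor <;> nlinarith

theorem add_smul_ind_mono (hlam : 0 ≤ lam) {S T : Finset N} (h : S ⊆ T) :
    x + lam • ind S ≤ x + lam • ind T := by
  refine add_le_add_right (smul_le_smul_of_nonneg_left (fun i => ?_) hlam) x
  by_cases hi : i ∈ S
  · simp [ind, hi, h hi]
  · simpa [ind, hi] using (ind_mem_cube T i).1

theorem multilinear_add_smul_ind_insert {T : Finset N} {a : N} (ha : a ∉ T) :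
    multilinear f (x + lam • ind (insert a T)) - multilinear f (x + lam • ind T) =
      lam * multilinear (marginal a f) (x + lam • ind T) := by
  have : x + lam • ind (insert a T) =
      Function.update (x + lam • ind T) a ((x + lam • ind T) a + lam) := by
    ext i
    by_cases hi : i = a
    · subst hi
      simp [ind, ha]
    · simp [ind, hi]
  rw [this, multilinear_update]
  ring

theorem monotone_step (hf : IsMonotoneSubmodular f) (hlam : 0 ≤ lam)
    (hx : ∀ i, 0 ≤ x i ∧ x i + lam ≤ 1) :
    Monotone fun T => multilinear f (x + lam • ind T) - multilinear f x :=
  fun S T h => sub_le_sub_right (multilinear_mono hf.2.1 (add_smul_ind_mem_cube_of_le hlam hx S)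
    (add_smul_ind_mem_cube_of_le hlam hx T) (add_smul_ind_mono hlam h)) _

theorem isSubmodular_step (hf : IsMonotoneSubmodular f) (hlam : 0 ≤ lam)
    (hx : ∀ i, 0 ≤ x i ∧ x i + lam ≤ 1) :
    IsSubmodular fun T => multilinear f (x + lam • ind T) - multilinear f x := by
  intro S T h a ha
  dsimp only
  rw [sub_sub_sub_cancel_right, sub_sub_sub_cancel_right, multilinear_add_smul_ind_insert ha,
    multilinear_add_smul_ind_insert fun haS => ha (h haS)]
  exact mul_le_mul_of_nonneg_left (multilinear_anti (marginal_antitone hf.2.2 a)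
    (add_smul_ind_mem_cube_of_le hlam hx S) (add_smul_ind_mem_cube_of_le hlam hx T)
    (add_smul_ind_mono hlam h)) hlam

theorem step_empty : multilinear f (x + lam • ind ∅) - multilinear f x = 0 := by
  have : ind (∅ : Finset N) = 0 := by
    ext i
    simp [ind]
  rw [this, smul_zero, add_zero, sub_self]

end step

/-! ### The optimum and the progress of one step -/

theorem le_opt {M : Matroid N} (f : Finset N → ℝ) {S : Finset N} (hS : feasible M S) :
    f S ≤ opt M f :=
  le_csSup (Set.toFinite _).bddAbove (Set.mem_image_of_mem f hS)

theorem exists_opt (M : Matroid N) (f : Finset N → ℝ) : ∃ O, feasible M O ∧ f O = opt M f := by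
  have hne : (f '' {S | feasible M S}).Nonempty :=
    ⟨f ∅, ∅, (Reached.empty (g := f)).feasible, rfl⟩
  exact hne.csSup_mem (Set.toFinite _)

theorem card_le_rank {M : Matroid N} {S : Finset N} (hS : feasible M S) :
    S.card ≤ rank (feasible M) :=
  Finset.le_sup (f := Finset.card) (Finset.mem_filter.2 ⟨Finset.mem_univ _, hS⟩)

theorem mul_one_sub_pow_numThresholds_le {k : ℕ} {ε lam : ℝ} (hε : 0 < ε) (hε' : ε ≤ 1)
    (hlam : 0 < lam) : k * (1 - ε) ^ numThresholds k ε lam ≤ ε * lam := by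
  rcases Nat.eq_zero_or_pos k with rfl | hk
  · simp
    positivity
  have hk' : (0 : ℝ) < k := by exact_mod_cast hk
  have hq : 0 < k / (ε * lam) := by positivity
  have h1 : (1 - ε) ^ numThresholds k ε lam ≤ Real.exp (-Real.log (k / (ε * lam))) := by
    calc (1 - ε) ^ numThresholds k ε lam ≤ Real.exp (-ε) ^ numThresholds k ε lam :=
          pow_le_pow_left₀ (by linarith) (Real.one_sub_le_exp_neg ε) _
      _ = Real.exp (numThresholds k ε lam * -ε) := (Real.exp_nat_mul _ _).symm
      _ ≤ _ := by
          refine Real.exp_le_exp.2 ?_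
          have := Nat.le_ceil (Real.log (k / (ε * lam)) / ε)
          rw [div_le_iff₀ hε] at this
          unfold numThresholds
          linarith
  rw [Real.exp_neg, Real.exp_log hq, inv_div] at h1
  calc k * (1 - ε) ^ numThresholds k ε lam ≤ k * (ε * lam / k) := by gcongr
    _ = ε * lam := by field_simp

section guarantee

variable {M : Matroid N} {f : Finset N → ℝ} {ε lam : ℝ}

theorem maxSingleton_step_le (hf : IsMonotoneSubmodular f) (hlam : 0 ≤ lam) {x : N → ℝ}
    (hx : ∀ i, 0 ≤ x i ∧ x i + lam ≤ 1) :
    maxSingleton (feasible M) (fun T => multilinear f (x + lam • ind T) - multilinear f x) ≤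
      lam * opt M f := by
  obtain ⟨O, hO, hO'⟩ := exists_opt M f
  rcases maxSingleton_mem (I := feasible M)
    (g := fun T => multilinear f (x + lam • ind T) - multilinear f x) with h | ⟨a, ha, h⟩
  · rw [h, ← hO']
    exact mul_nonneg hlam (hf.1 O)
  · have h0 : x + lam • ind ∅ ∈ cube := add_smul_ind_mem_cube_of_le hlam hx ∅
    have h1 := multilinear_add_smul_ind_insert (f := f) (x := x) (lam := lam)
      (Finset.notMem_empty a)
    have h2 := step_empty (f := f) (x := x) (lam := lam)
    have h3 : multilinear (marginal a f) (x + lam • ind ∅) ≤ marginal a f ∅ := by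
      rw [← multilinear_ind (marginal a f) ∅]
      refine multilinear_anti (marginal_antitone hf.2.2 a) (ind_mem_cube ∅) h0 fun i => ?_
      simpa [ind] using (hx i).1
    have h4 : marginal a f ∅ ≤ opt M f := by
      have h5 := le_opt f ha
      have h6 := hf.1 ∅
      simp only [marginal, insert_empty_eq, Finset.erase_empty]
      linarith
    rw [h]
    rw [insert_empty_eq] at h1
    have := mul_le_mul_of_nonneg_left (h3.trans h4) hlam
    linarith

theorem mean_adaptiveSequencing_step_le (hf : IsMonotoneSubmodular f) (hε : 0 < ε)
    (hε' : ε < 1 / 2) (hlam : 0 < lam) {x : N → ℝ} (hx : ∀ i, 0 ≤ x i ∧ x i + lam ≤ 1) {θ : ℝ}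
    (hθ : 0 ≤ θ) (hθ' : θ * (lam * opt M f) ≤ 1) :
    mean ((adaptiveSequencing (feasible M) ε (numThresholds (rank (feasible M)) ε lam)).run
        fun T => multilinear f (x + lam • ind T) - multilinear f x)
      (fun S => ENNReal.ofReal (Real.exp (θ * ((1 + (1 - ε) * (1 - 2 * ε) * lam) *
        (opt M f - multilinear f (x + lam • ind S)))))) ≤
      ENNReal.ofReal (Real.exp (θ * (opt M f - multilinear f x +
        2 * ε * lam ^ 2 * opt M f))) := by
  obtain ⟨O, hO, hO'⟩ := exists_opt M f
  have hopt : 0 ≤ opt M f := hO' ▸ hf.1 O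
  set κ := (1 - ε) * (1 - 2 * ε) with hκ
  have hκ0 : 0 ≤ κ := mul_nonneg (by linarith) (by linarith)
  have hκ1 : κ ≤ 1 := by nlinarith
  set B := θ * (opt M f - multilinear f x + 2 * ε * lam ^ 2 * opt M f) with hB
  have hmax := maxSingleton_step_le (M := M) hf hlam.le hx
  have hmax0 : 0 ≤ maxSingleton (feasible M)
      (fun T => multilinear f (x + lam • ind T) - multilinear f x) := by
    rcases maxSingleton_mem (I := feasible M)
      (g := fun T => multilinear f (x + lam • ind T) - multilinear f x) with h | ⟨a, -, h⟩
    · exact h.ge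
    · rw [h, ← step_empty (f := f) (x := x) (lam := lam)]
      exact monotone_step hf hlam.le hx (Finset.empty_subset _)
  have key := mean_adaptiveSequencing_le (M := M) (ε := ε) (θ := θ)
    (monotone_step hf hlam.le hx) (isSubmodular_step hf hlam.le hx) step_empty hε (by linarith) hθ
    (mul_nonneg (by linarith) hθ) ((mul_le_mul_of_nonneg_left hmax hθ).trans hθ')
    (numThresholds (rank (feasible M)) ε lam)
    -- Dividing by `exp B` matches the normalisation in which the potential starts at `1`.
    (Ψ := fun S => ENNReal.ofReal (Real.exp (θ * ((1 + κ * lam) *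
        (opt M f - multilinear f (x + lam • ind S))) - B))) ?_
  · have e : ∀ S : Finset N, ENNReal.ofReal (Real.exp (θ * ((1 + κ * lam) *
        (opt M f - multilinear f (x + lam • ind S))))) = ENNReal.ofReal (Real.exp B) *
          ENNReal.ofReal (Real.exp (θ * ((1 + κ * lam) *
            (opt M f - multilinear f (x + lam • ind S))) - B)) := fun S => by
      rw [← ENNReal.ofReal_mul (Real.exp_pos _).le, ← Real.exp_add, add_sub_cancel]
    simp only [e]
    rw [mean_const_mul]
    exact mul_le_of_le_one_right' key
  · intro S s hR hM
    set t := maxSingleton (feasible M)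
      (fun T => multilinear f (x + lam • ind T) - multilinear f x)
    refine ENNReal.ofReal_le_ofReal (Real.exp_le_exp.2 ?_)
    have h1ε : 0 < 1 - ε := by linarith
    have hT : 0 ≤ (1 - ε) ^ numThresholds (rank (feasible M)) ε lam * t / (1 - ε) := by positivity
    set T := (1 - ε) ^ numThresholds (rank (feasible M)) ε lam * t / (1 - ε) with hTdef
    have hy := add_smul_ind_mem_cube_of_le hlam.le hx S
    have h1 := hR.sum_le_add hT hM
      (d := fun o => lam * multilinear (marginal o f) (x + lam • ind S)) (fun A hA o ho => by
        rw [sub_sub_sub_cancel_right, multilinear_add_smul_ind_insert ho]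
        exact mul_le_mul_of_nonneg_left (multilinear_anti (marginal_antitone hf.2.2 o)
          (add_smul_ind_mem_cube_of_le hlam.le hx A) hy (add_smul_ind_mono hlam.le hA)) hlam.le) hO
    rw [← Finset.mul_sum] at h1
    have h2 := le_multilinear_add_sum_marginal hf.2.1 hf.2.2 hy O
    rw [hO'] at h2
    -- Truncation error: the first threshold is at most `lam * opt M f`, the number of thresholds
    -- makes `k (1 - ε) ^ Δ ≤ ε lam`, and `1 / (1 - ε) ≤ 2`.
    have h3 : O.card * T ≤ 2 * ε * lam ^ 2 * opt M f := by
      calc O.card * T ≤ rank (feasible M) * T := by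
            gcongr
            exact card_le_rank hO
        _ = (rank (feasible M) * (1 - ε) ^ numThresholds (rank (feasible M)) ε lam) * t /
              (1 - ε) := by
            rw [hTdef]
            ring
        _ ≤ (ε * lam) * (lam * opt M f) / (1 - ε) := by
            exact div_le_div_of_nonneg_right (mul_le_mul
              (mul_one_sub_pow_numThresholds_le hε (by linarith) hlam) hmax hmax0
              (by positivity)) h1ε.le
        _ ≤ _ := by
            rw [div_le_iff₀ h1ε]
            have : 0 ≤ ε * lam ^ 2 * opt M f := by positivity
            nlinarith
    have h4 : lam * (opt M f - multilinear f (x + lam • ind S)) ≤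
        s + 2 * ε * lam ^ 2 * opt M f := by
      have := mul_le_mul_of_nonneg_left h2 hlam.le
      linarith
    have h5 := mul_le_mul_of_nonneg_left h4 hκ0
    have h6 : κ * (2 * ε * lam ^ 2 * opt M f) ≤ 2 * ε * lam ^ 2 * opt M f :=
      mul_le_of_le_one_left (by positivity) hκ1
    have h7 : (1 + κ * lam) * (opt M f - multilinear f (x + lam • ind S)) -
        (opt M f - multilinear f x + 2 * ε * lam ^ 2 * opt M f) ≤
        κ * s - (multilinear f (x + lam • ind S) - multilinear f x) := by linarith
    have := mul_le_mul_of_nonneg_left h7 hθ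
    rw [hB, ← mul_sub]
    exact this

/-! ### All steps together -/

theorem add_smul_ind_bounds (hlam : 0 ≤ lam) {j : ℕ} {x : N → ℝ}
    (hx : ∀ i, 0 ≤ x i ∧ x i + (j + 1 : ℕ) * lam ≤ 1) :
    (∀ i, 0 ≤ x i ∧ x i + lam ≤ 1) ∧
      ∀ (T : Finset N) i, 0 ≤ (x + lam • ind T) i ∧ (x + lam • ind T) i + j * lam ≤ 1 := by
  have hj : 0 ≤ j * lam := by positivity
  push_cast at hx
  refine ⟨fun i => ⟨(hx i).1, by linarith [(hx i).2]⟩, fun T i => ?_⟩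
  have h1 := ind_mem_cube T i
  have h2 := hx i
  simp only [Pi.add_apply, Pi.smul_apply, smul_eq_mul]
  constructor <;> nlinarith

/-- The induction hypothesis treats all steps but the first. Its division by `a ^ j` turns the first
step into the one-step bound with parameter `θ / a ^ (j + 1) ≤ θ`, which is again admissible. -/
theorem mean_greedyLoop_le (hf : IsMonotoneSubmodular f) (hε : 0 < ε) (hε' : ε < 1 / 2)
    (hlam : 0 < lam) : ∀ (j : ℕ) (x : N → ℝ), (∀ i, 0 ≤ x i ∧ x i + j * lam ≤ 1) →
      ∀ θ : ℝ, 0 ≤ θ → θ * (lam * opt M f) ≤ 1 →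
      mean ((greedyLoop (feasible M) ε (numThresholds (rank (feasible M)) ε lam) lam j x).run
          (multilinear f)) (fun y => ENNReal.ofReal (Real.exp (θ * (opt M f - multilinear f y)))) ≤
        ENNReal.ofReal (Real.exp (θ * ((opt M f - multilinear f x) /
          (1 + (1 - ε) * (1 - 2 * ε) * lam) ^ j + j * (2 * ε * lam ^ 2 * opt M f)))) := by
  obtain ⟨O, -, hO⟩ := exists_opt M f
  have hopt : 0 ≤ opt M f := hO ▸ hf.1 O
  set a := 1 + (1 - ε) * (1 - 2 * ε) * lam with ha
  have ha1 : 1 ≤ a := by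
    have : 0 ≤ (1 - ε) * (1 - 2 * ε) * lam :=
      mul_nonneg (mul_nonneg (by linarith) (by linarith)) hlam.le
    linarith
  set τ := 2 * ε * lam ^ 2 * opt M f with hτ
  have hτ0 : 0 ≤ τ := by positivity
  intro j
  induction j with
  | zero =>
    intro x _ θ _ _
    rw [greedyLoop, Alg.run, mean_pure]
    simp
  | succ j ih =>
    intro x hx θ hθ hθ'
    obtain ⟨hx1, hx2⟩ := add_smul_ind_bounds hlam.le hx
    have haj : 1 ≤ a ^ (j + 1) := one_le_pow₀ ha1
    have haj0 : 0 < a ^ (j + 1) := by positivity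
    have hθa : θ / a ^ (j + 1) ≤ θ := div_le_self hθ haj
    rw [greedyLoop, Alg.run_bind, mean_bind, run_onStep]
    calc _ ≤ mean ((adaptiveSequencing (feasible M) ε (numThresholds (rank (feasible M)) ε lam)).run
            fun T => multilinear f (x + lam • ind T) - multilinear f x) fun S =>
            ENNReal.ofReal (Real.exp (θ * (j * τ))) * ENNReal.ofReal (Real.exp
              (θ / a ^ (j + 1) * (a * (opt M f - multilinear f (x + lam • ind S))))) := by
          refine mean_mono fun S _ => (ih _ (hx2 S) θ hθ hθ').trans (le_of_eq ?_)
          rw [← ENNReal.ofReal_mul (Real.exp_pos _).le, ← Real.exp_add]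
          congr 2
          field_simp
          ring
      _ ≤ ENNReal.ofReal (Real.exp (θ * (j * τ))) * ENNReal.ofReal (Real.exp
            (θ / a ^ (j + 1) * (opt M f - multilinear f x + τ))) := by
          rw [mean_const_mul]
          gcongr
          refine mean_adaptiveSequencing_step_le hf hε hε' hlam hx1 (by positivity) ?_
          exact (mul_le_mul_of_nonneg_right hθa (by positivity)).trans hθ'
      _ ≤ _ := by
          rw [← ENNReal.ofReal_mul (Real.exp_pos _).le, ← Real.exp_add]
          refine ENNReal.ofReal_le_ofReal (Real.exp_le_exp.2 ?_)
          have := mul_le_mul_of_nonneg_right hθa hτ0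
          have e : θ / a ^ (j + 1) * (opt M f - multilinear f x) =
              θ * ((opt M f - multilinear f x) / a ^ (j + 1)) := by ring
          push_cast
          rw [mul_add (θ / a ^ (j + 1)), e]
          linarith

/-- At `θ = 0` the potential is constantly `1`. A terminal value that is `∞` on infeasible sets then
still has mean at most `1`, so such sets have probability zero. -/
theorem feasible_of_mem_support_adaptiveSequencing {g : Finset N → ℝ} (hmono : Monotone g)
    (hg : IsSubmodular g) (hg0 : g ∅ = 0) (hε : 0 < ε) (hε' : ε < 1) {Δ : ℕ} {S : Finset N}
    (hS : S ∈ ((adaptiveSequencing (feasible M) ε Δ).run g).support) : feasible M S := by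
  have key := mean_adaptiveSequencing_le (M := M) (θ := 0) hmono hg hg0 hε hε' le_rfl (by simp)
    (by simp) Δ (Ψ := fun S => if feasible M S then 0 else ∞) fun S s hR _ => by
      rw [if_pos hR.feasible]
      exact zero_le
  by_contra h
  have h1 := (ENNReal.le_tsum S).trans key
  simp only [if_neg h] at h1
  rw [ENNReal.mul_top hS] at h1
  exact absurd h1 (by simp)

/-- The witness `p` is the average of the indicators of the sets chosen in the steps. -/
theorem mem_support_greedyLoop (hf : IsMonotoneSubmodular f) (hε : 0 < ε) (hε' : ε < 1)
    (hlam : 0 ≤ lam) (Δ : ℕ) : ∀ (j : ℕ) (x : N → ℝ), (∀ i, 0 ≤ x i ∧ x i + j * lam ≤ 1) →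
      ∀ y ∈ ((greedyLoop (feasible M) ε Δ lam j x).run (multilinear f)).support,
        ∃ p ∈ polytope M, y = x + (j * lam) • p := by
  intro j
  induction j with
  | zero =>
    intro x _ y hy
    rw [greedyLoop, Alg.run, PMF.mem_support_pure_iff] at hy
    exact ⟨ind ∅, subset_convexHull ℝ _ ⟨∅, (Reached.empty (g := f)).feasible, rfl⟩, by simp [hy]⟩
  | succ j ih =>
    intro x hx y hy
    obtain ⟨hx1, hx2⟩ := add_smul_ind_bounds hlam hx
    rw [greedyLoop, Alg.run_bind, run_onStep, PMF.mem_support_bind_iff] at hy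
    obtain ⟨S, hS, hy⟩ := hy
    have hS' := feasible_of_mem_support_adaptiveSequencing (monotone_step hf hlam hx1)
      (isSubmodular_step hf hlam hx1) step_empty hε hε' hS
    obtain ⟨p, hp, rfl⟩ := ih _ (hx2 S) y hy
    have hj : (0 : ℝ) < j + 1 := by positivity
    refine ⟨(1 / (j + 1 : ℝ)) • ind S + (j / (j + 1 : ℝ)) • p,
      (convex_convexHull ℝ (ind '' {S | feasible M S})) (subset_convexHull ℝ _ ⟨S, hS', rfl⟩) hp (by positivity)
        (by positivity) (by field_simp; ring), ?_⟩
    ext i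
    simp only [Pi.add_apply, Pi.smul_apply, smul_eq_mul]
    push_cast
    field_simp
    ring

theorem mem_polytope_of_mem_support (hf : IsMonotoneSubmodular f) (hε : 0 < ε) (hε' : ε < 1)
    {m : ℕ} (hm : 1 ≤ m) {x : N → ℝ}
    (hx : x ∈ ((acceleratedContinuousGreedy M ε m).run (multilinear f)).support) :
    x ∈ polytope M := by
  have hm' : (m : ℝ) ≠ 0 := by positivity
  obtain ⟨p, hp, rfl⟩ := mem_support_greedyLoop hf hε hε' (by positivity) _ m 0
    (fun i => by simp [hm']) x hx
  simpa [hm'] using hp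

/-- `(1 + κ / m) ^ (-m)` is at most `e⁻¹ + O(ε)` when `κ = 1 - O(ε)` and `1 / m = O(ε)`. -/
theorem inv_one_add_pow_le {c : ℝ} (hc : 0 ≤ c) (hε : 0 < ε) (hcε : (3 + c) * ε ≤ 1) {m : ℕ}
    (hm : 1 ≤ m) (hlam : lam = 1 / m) (hlamε : lam ≤ c * ε) :
    1 / (1 + (1 - ε) * (1 - 2 * ε) * lam) ^ m ≤ 1 / Real.exp 1 + 2 * ((3 + c) * ε) := by
  have hm' : (0 : ℝ) < m := by exact_mod_cast hm
  have hlam0 : 0 < lam := hlam ▸ one_div_pos.2 hm'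
  have hml : m * lam = 1 := by
    rw [hlam]
    field_simp
  have hε3 : ε ≤ 1 / 3 := by nlinarith
  set κ := (1 - ε) * (1 - 2 * ε) with hκ
  have hκ0 : 0 ≤ κ := mul_nonneg (by linarith) (by linarith)
  have hκ1 : κ ≤ 1 := by nlinarith
  have hκ3 : 1 - 3 * ε ≤ κ := by nlinarith
  set y := κ * lam with hy
  have hy0 : 0 ≤ y := by positivity
  set z := (3 + c) * ε with hz
  have hz0 : 0 ≤ z := by positivity
  -- `(1 + y)(1 - y + y ^ 2) = 1 + y ^ 3 ≥ 1`.
  have h1 : 1 / (1 + y) ≤ Real.exp (-(y - y ^ 2)) := by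
    have h2 := Real.one_sub_le_exp_neg (y - y ^ 2)
    refine le_trans ?_ h2
    rw [div_le_iff₀ (by linarith)]
    nlinarith [pow_nonneg hy0 3]
  have h2 : m * (y - y ^ 2) ≥ 1 - z := by
    have : m * (y - y ^ 2) = κ - κ ^ 2 * lam := by
      linear_combination (κ - κ ^ 2 * lam) * hml
    have h3 : κ ^ 2 * lam ≤ lam := mul_le_of_le_one_left hlam0.le (pow_le_one₀ hκ0 hκ1)
    rw [this]
    linarith
  have h3 : Real.exp z ≤ 1 + 2 * z := by
    have := (abs_le.1 (Real.abs_exp_sub_one_sub_id_le (x := z) (by rwa [abs_of_nonneg hz0]))).2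
    nlinarith
  calc 1 / (1 + y) ^ m = (1 / (1 + y)) ^ m := (one_div_pow _ _).symm
    _ ≤ Real.exp (-(y - y ^ 2)) ^ m := pow_le_pow_left₀ (by positivity) h1 m
    _ = Real.exp (m * -(y - y ^ 2)) := (Real.exp_nat_mul _ _).symm
    _ ≤ Real.exp (-1 + z) := Real.exp_le_exp.2 (by linarith)
    _ = Real.exp (-1) * Real.exp z := Real.exp_add _ _
    _ ≤ Real.exp (-1) * (1 + 2 * z) := by gcongr
    _ ≤ Real.exp (-1) + 2 * z := by
        have : Real.exp (-1) ≤ 1 := Real.exp_le_one_iff.2 (by norm_num)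
        nlinarith
    _ = _ := by rw [Real.exp_neg, one_div]

/-- Markov's inequality at the largest admissible `θ = 1 / (lam OPT)`. The losses add up to `8 +
3c`: `2 (3 + c)` from the contraction, `2` from truncation, `c` from `lam log (1 / δ) ≤ c ε`. -/
theorem ofReal_one_sub_le_run (hf : IsMonotoneSubmodular f) {c δ : ℝ} (hc : 0 ≤ c) (hε : 0 < ε)
    (hcε : (3 + c) * ε ≤ 1) (hδ : 0 < δ) (hδ' : δ < 1) {m : ℕ} (hm : 1 ≤ m) (hlam : lam = 1 / m)
    (hlamε : lam ≤ c * ε) (hlamδ : lam ≤ c * (ε / Real.log (1 / δ))) (hopt : 0 < opt M f)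
    {E : Set (N → ℝ)}
    (hE : ∀ y ∈ ((acceleratedContinuousGreedy M ε m).run (multilinear f)).support,
      (1 - 1 / Real.exp 1 - (8 + 3 * c) * ε) * opt M f ≤ multilinear f y → y ∈ E) :
    ENNReal.ofReal (1 - δ) ≤
      ((acceleratedContinuousGreedy M ε m).run (multilinear f)).toOuterMeasure E := by
  have hm' : (0 : ℝ) < m := by exact_mod_cast hm
  have hlam0 : 0 < lam := hlam ▸ one_div_pos.2 hm'
  have hml : m * lam = 1 := by
    rw [hlam]
    field_simp
  have hlam1 : lam ≤ 1 := by
    have : (1 : ℝ) ≤ m := by exact_mod_cast hm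
    nlinarith
  have hpow := inv_one_add_pow_le hc hε hcε hm hlam hlamε
  have key := mean_greedyLoop_le (M := M) hf hε (by nlinarith) hlam0 m 0
    (fun i => by simp [hml]) (1 / (lam * opt M f)) (by positivity)
    (one_div_mul_cancel (by positivity)).le
  set θ := 1 / (lam * opt M f) with hθ
  have hθ0 : 0 < θ := by positivity
  set a := 1 + (1 - ε) * (1 - 2 * ε) * lam
  have ha : 0 < a := by
    have : 0 ≤ (1 - ε) * (1 - 2 * ε) * lam :=
      mul_nonneg (mul_nonneg (by nlinarith) (by nlinarith)) hlam0.le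
    linarith
  set B := θ * ((opt M f - multilinear f 0) / a ^ m + m * (2 * ε * lam ^ 2 * opt M f)) with hB
  have hlog : 0 < Real.log (1 / δ) := Real.log_pos (by rw [lt_div_iff₀ hδ]; linarith)
  refine ofReal_one_sub_le_toOuterMeasure
    (c := ENNReal.ofReal (Real.exp (B + Real.log (1 / δ))))
    (φ := fun y => ENNReal.ofReal (Real.exp (θ * (opt M f - multilinear f y))))
    (by simpa using Real.exp_pos _) ENNReal.ofReal_ne_top hδ.le ?_ fun y hy hlt => hE y hy ?_
  · rw [← ENNReal.ofReal_mul (Real.exp_pos _).le, Real.exp_add, Real.exp_log (by positivity),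
      mul_assoc, one_div_mul_cancel hδ.ne', mul_one]
    rw [acceleratedContinuousGreedy, ← hlam]
    exact key
  · rw [ENNReal.ofReal_lt_ofReal_iff (Real.exp_pos _), Real.exp_lt_exp] at hlt
    have h0 : 0 ≤ multilinear f 0 := multilinear_nonneg hf.1 fun i => by simp
    have h1 : (opt M f - multilinear f 0) / a ^ m ≤
        opt M f * (1 / Real.exp 1 + 2 * ((3 + c) * ε)) := by
      calc (opt M f - multilinear f 0) / a ^ m ≤ opt M f / a ^ m := by
            gcongr
            linarith
        _ = opt M f * (1 / a ^ m) := by ring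
        _ ≤ _ := by gcongr
    have h2 : m * (2 * ε * lam ^ 2 * opt M f) ≤ opt M f * (2 * ε) := by
      have : m * (2 * ε * lam ^ 2 * opt M f) = opt M f * (2 * ε) * lam := by
        linear_combination (2 * ε * lam * opt M f) * hml
      rw [this]
      exact mul_le_of_le_one_right (by positivity) hlam1
    have h3 : lam * Real.log (1 / δ) ≤ c * ε := by
      rwa [← mul_div_assoc, le_div_iff₀ hlog] at hlamδ
    have h4 : θ * (opt M f - multilinear f y) <
        θ * ((opt M f - multilinear f 0) / a ^ m + m * (2 * ε * lam ^ 2 * opt M f) +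
          lam * opt M f * Real.log (1 / δ)) := by
      refine hlt.trans_eq ?_
      have : θ * (lam * opt M f) = 1 := one_div_mul_cancel (by positivity)
      rw [hB]
      linear_combination (-Real.log (1 / δ)) * this
    have h5 := lt_of_mul_lt_mul_left h4 hθ0.le
    have h6 := mul_le_mul_of_nonneg_left h3 hopt.le
    linarith

theorem approximates_acceleratedContinuousGreedy {ρ : (N → ℝ) → PMF (Finset N)}
    (hρ : IsRounding M ρ) (hf : IsMonotoneSubmodular f) {c δ : ℝ} (hc : 0 ≤ c) (hε : 0 < ε)
    (hε' : ε < 1) (hδ : 0 < δ) (hδ' : δ < 1) {m : ℕ} (hm : 1 ≤ m) (hlam : lam = 1 / m)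
    (hlamε : lam ≤ c * ε) (hlamδ : lam ≤ c * (ε / Real.log (1 / δ))) :
    Approximates (acceleratedContinuousGreedy M ε m) M ρ f
      (1 - 1 / Real.exp 1 - (8 + 3 * c) * ε) δ := by
  have hpoly := fun x hx => mem_polytope_of_mem_support (M := M) hf hε hε' hm (x := x) hx
  refine ⟨hpoly, ?_⟩
  have hE : ∀ y ∈ ((acceleratedContinuousGreedy M ε m).run (multilinear f)).support,
      (1 - 1 / Real.exp 1 - (8 + 3 * c) * ε) * opt M f ≤ multilinear f y →
      y ∈ {x | (1 - 1 / Real.exp 1 - (8 + 3 * c) * ε) * opt M f ≤ multilinear f x ∧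
        (1 - 1 / Real.exp 1 - (8 + 3 * c) * ε) * opt M f ≤ expect (ρ x) f} :=
    fun y hy h => ⟨h, h.trans ((hρ y (hpoly y hy)).2 f hf)⟩
  -- Otherwise the target is non-positive: either its factor is negative or the optimum is `0`.
  by_cases h : (3 + c) * ε ≤ 1 ∧ 0 < opt M f
  · exact ofReal_one_sub_le_run hf hc hε h.1 hδ hδ' hm hlam hlamε hlamδ h.2 hE
  · have htriv : (1 - 1 / Real.exp 1 - (8 + 3 * c) * ε) * opt M f ≤ 0 := by
      obtain ⟨O, -, hO⟩ := exists_opt M f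
      have hopt : 0 ≤ opt M f := hO ▸ hf.1 O
      rcases not_and_or.1 h with h | h
      · refine mul_nonpos_of_nonpos_of_nonneg ?_ hopt
        have : 0 < 1 / Real.exp 1 := by positivity
        nlinarith
      · rw [le_antisymm (not_lt.1 h) hopt, mul_zero]
    rw [(PMF.toOuterMeasure_apply_eq_one_iff _ _).2 fun y hy => hE y hy (htriv.trans
      (multilinear_nonneg hf.1 (polytope_subset_cube M (hpoly y hy))))]
    exact ENNReal.ofReal_le_one.2 (by linarith)

theorem Approximates.mono {A : Alg (N → ℝ) (N → ℝ)} {ρ : (N → ℝ) → PMF (Finset N)} {a b δ : ℝ}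
    (h : Approximates A M ρ f a δ) (hf : IsMonotoneSubmodular f) (hba : b ≤ a) :
    Approximates A M ρ f b δ := by
  obtain ⟨O, -, hO⟩ := exists_opt M f
  have := mul_le_mul_of_nonneg_right hba (hO ▸ hf.1 O : 0 ≤ opt M f)
  exact ⟨h.1, h.2.trans (MeasureTheory.measure_mono fun x hx =>
    ⟨this.trans hx.1, this.trans hx.2⟩)⟩

end guarantee

end Adaptive

end

theorem mainTheorem1 :
    ∃ (q : Polynomial ℕ)
      (ρ : ∀ n : ℕ, Matroid (Fin n) → (Fin n → ℝ) → PMF (Finset (Fin n))),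
      (∀ (n : ℕ) (M : Matroid (Fin n)), Adaptive.IsRounding M (ρ n M)) ∧
      (∀ c : ℝ, 0 < c → ∃ C : ℝ, 0 < C ∧
        ∀ (n : ℕ) (M : Matroid (Fin n)) (k : ℕ), k = Adaptive.rank (Adaptive.feasible M) →
        ∀ (ε δ : ℝ) (m : ℕ) (lam : ℝ), 0 < ε → ε < 1 → 0 < δ → δ < 1 → 1 ≤ m → lam = 1 / m →
          lam ≤ c * ε → lam ≤ c * (ε / Real.log (1 / δ)) →
          (2 ≤ n → 1 ≤ k → ε * lam ≤ 1 / 2 →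
            ∃ r : ℕ, (r : ℝ) ≤ C * (Real.log n * Real.log (k / (ε * lam)) / (ε ^ 2 * lam)) ∧
              (Adaptive.acceleratedContinuousGreedy M ε m).IsAdaptive
                Adaptive.cube (q.eval n) r) ∧
          (∀ f : Finset (Fin n) → ℝ, Adaptive.IsMonotoneSubmodular f →
            Adaptive.Approximates (Adaptive.acceleratedContinuousGreedy M ε m) M (ρ n M) f
              (1 - 1 / Real.exp 1 - C * ε) δ)) ∧
      (∃ C : ℝ, 0 < C ∧
        ∀ (n : ℕ) (M : Matroid (Fin n)) (k : ℕ), k = Adaptive.rank (Adaptive.feasible M) →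
        ∀ (ε δ lam : ℝ) (m : ℕ), 0 < ε → ε ≤ 1 / 2 → 0 < δ → δ ≤ 1 / 2 →
          lam = ε ^ 2 / Real.log (1 / δ) → m = ⌈ε / lam⌉₊ →
          (2 ≤ n → 1 ≤ k →
            ∃ r : ℕ, (r : ℝ) ≤ C * (Real.log n * Real.log (k / (ε * lam)) / (ε * lam)) ∧
              (Adaptive.acceleratedContinuousGreedy M ε m).IsAdaptive
                Adaptive.cube (q.eval n) r) ∧
          (∀ f : Finset (Fin n) → ℝ, Adaptive.IsMonotoneSubmodular f →
            Adaptive.Approximates (Adaptive.acceleratedContinuousGreedy M ε m) M (ρ n M) f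
              (1 - 1 / Real.exp 1 - C * ε) δ)) := by
  choose ρ hρ using fun (n : ℕ) (M : Matroid (Fin n)) => Adaptive.exists_isRounding M
  have hq : ∀ n : ℕ, ((Polynomial.X + 1) ^ 2 + 1 : Polynomial ℕ).eval n = (n + 1) ^ 2 + 1 :=
    fun n => by simp
  -- A pass asks at most `(n + 1) ^ 2` values of `g`, and the value at `x` adds one. The first
  -- constant sums those for rounds and for approximation; `26 = 2 * 13` also dominates `8 + 3 * 2`,
  -- the approximation constant for `c = 2`.
  refine ⟨(Polynomial.X + 1) ^ 2 + 1, ρ, hρ, fun c hc => ⟨13 + (8 + 3 * c), by positivity, ?_⟩,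
    26, by norm_num, ?_⟩
  · intro n M k hk ε δ m lam hε hε' hδ hδ' hm hlam hlamε hlamδ
    have hm' : (0 : ℝ) < m := by exact_mod_cast hm
    refine ⟨fun hn hk1 hεlam => ?_, fun f hf => ?_⟩
    · subst hlam
      obtain ⟨r, hr, hA⟩ := Adaptive.exists_isAdaptive_acceleratedContinuousGreedy hn M hk hk1 hε
        hε'.le hm hεlam
      refine ⟨r, hr.trans ?_, by rwa [hq]⟩
      have h1 := Adaptive.log_two_le_log_div hε (one_div_pos.2 hm') hk1 hεlam
      have h2 := Real.log_pos one_lt_two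
      have h3 : 0 ≤ Real.log n := Real.log_natCast_nonneg n
      have h4 : 0 ≤ Real.log (k / (ε * (1 / m))) := by linarith
      gcongr
      linarith
    · exact (Adaptive.approximates_acceleratedContinuousGreedy (hρ n M) hf hc.le hε hε' hδ hδ' hm
        hlam hlamε hlamδ).mono hf (by nlinarith)
  · intro n M k hk ε δ lam m hε hε' hδ hδ' hlam hm
    have hL2 : 1 / 2 ≤ Real.log (1 / δ) := by
      have h1 : Real.log 2 ≤ Real.log (1 / δ) :=
        Real.log_le_log two_pos (by rw [le_div_iff₀ hδ]; linarith)
      linarith [Real.log_two_gt_d9]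
    have hL : 0 < Real.log (1 / δ) := by linarith
    have hlam0 : 0 < lam := by
      rw [hlam]
      positivity
    have hml : ε / lam ≤ m := hm ▸ Nat.le_ceil _
    have hm0 : (0 : ℝ) < m := lt_of_lt_of_le (by positivity) hml
    have hm1 : 1 ≤ m := by exact_mod_cast hm0
    have hεL : ε / lam = Real.log (1 / δ) / ε := by
      rw [hlam]
      field_simp
    have hstep : (1 : ℝ) / m ≤ ε / Real.log (1 / δ) := by
      rw [hεL] at hml
      rw [← one_div_div (Real.log (1 / δ)) ε]
      exact one_div_le_one_div_of_le (by positivity) hml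
    refine ⟨fun hn hk1 => ?_, fun f hf => ?_⟩
    · have hk' : (1 : ℝ) ≤ k := by exact_mod_cast hk1
      have hstep2 : (1 : ℝ) / m ≤ 1 := by
        rw [div_le_iff₀ hm0]
        linarith [show (1 : ℝ) ≤ m by exact_mod_cast hm1]
      obtain ⟨r, hr, hA⟩ := Adaptive.exists_isAdaptive_acceleratedContinuousGreedy hn M hk hk1 hε
        (by linarith) hm1 (by nlinarith)
      refine ⟨r, hr.trans ?_, by rwa [hq]⟩
      -- `ε / lam = log (1 / δ) / ε`, with numerator at least `1 / 2` and denominator at most `1 /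
      -- 2`. Thus the ceiling at most doubles `ε / lam`.
      have h1 : 1 ≤ ε / lam := by
        rw [hεL, le_div_iff₀ hε]
        linarith
      have hm2 : (m : ℝ) ≤ 2 * (ε / lam) := by
        have := Nat.ceil_lt_add_one (by positivity : 0 ≤ ε / lam)
        rw [← hm] at this
        linarith
      have h3 : 0 ≤ Real.log n := Real.log_natCast_nonneg n
      -- The factor `2` from the ceiling is absorbed by `2 * ε ≤ 1`, so the logarithm costs no
      -- further constant.
      have h4 : Real.log (k / (ε * (1 / m))) ≤ Real.log (k / (ε * lam)) := by
        refine Real.log_le_log (by positivity) ?_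
        calc k / (ε * (1 / m)) = k * m / ε := by field_simp
          _ ≤ k * (2 * (ε / lam)) / ε := by gcongr
          _ = 2 * ε * (k / (ε * lam)) := by field_simp
          _ ≤ k / (ε * lam) := mul_le_of_le_one_left (by positivity) (by linarith)
      have h5 : 0 ≤ Real.log (k / (ε * lam)) := by
        refine le_trans ?_ h4
        have := Adaptive.log_two_le_log_div hε (one_div_pos.2 hm0) hk1 (by nlinarith)
        linarith [Real.log_pos one_lt_two]
      calc 13 * (Real.log n * Real.log (k / (ε * (1 / m))) / (ε ^ 2 * (1 / m)))
          = 13 * (Real.log n * Real.log (k / (ε * (1 / m)))) * m / ε ^ 2 := by field_simp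
        _ ≤ 13 * (Real.log n * Real.log (k / (ε * lam))) * (2 * (ε / lam)) / ε ^ 2 := by gcongr
        _ = 26 * (Real.log n * Real.log (k / (ε * lam)) / (ε * lam)) := by
          field_simp
          ring
    · refine (Adaptive.approximates_acceleratedContinuousGreedy (hρ n M) hf two_pos.le hε
        (by linarith) hδ (by linarith) hm1 rfl ?_ ?_).mono hf (by nlinarith)
      · refine hstep.trans ?_
        rw [div_le_iff₀ hL]
        nlinarith
      · have : 0 < ε / Real.log (1 / δ) := by positivity
        linarith
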